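/- Let $(W_t)_{t\ge 0}$ be a standard Brownian motion with respect to a filtration $(\mathcal F_t)_{t\ge0}$ on a probability space, let $(\sigma_t)_{t\ge 0}$ be a stationary, $[0,+\infty)$-valued, progressively measurable process that is independent of $(W_t)_{t\ge 0}$, and let $(X_t)_{t\ge 0}$ satisfy $dX_t=\sigma_t\,dW_t$ in the sense of the It\^o integral. Assume (A) $\frac1h\int_0^h(\sigma_s-\sigma_0)^2\,ds\to 0$ in probability as $h\downarrow 0$; (B) $\mathbb E[\sigma_0^2]<+\infty$. Fix $t\ge 0$. For $q\ge 1$ put $$A(q):=\limsup_{h\downarrow 0}\frac{\log \mathbb E\left[|X_{t+h}-X_t|^q\right]}{\log h}\in[-\infty,+\infty],$$ where $\log 0=-\infty$ and $\log(+\infty)=+\infty$. We say that multi-scaling occurs if the set $\{q\ge 1:\ -\infty<A(q)<q/2\}$ has nonempty interior. If multi-scaling occurs, then there exists $p>2$ such that $$\mathbb E\left[\left(\frac1h\int_0^h\sigma_s^2\,ds\right)^{p/2}\right]<+\infty\quad\text{for every } h>0,\qquad\text{but}\qquad \mathbb E\left[\sigma_0^p\right]=+\infty .$$ -/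

import Mathlib

open MeasureTheory ProbabilityTheory Filter Topology
open scoped NNReal ENNReal

noncomputable section

namespace StochVol

variable {Ω : Type*} {mΩ : MeasurableSpace Ω}

/-- The Lebesgue integral `∫_0^h f(s) ds` of a `[0, ∞]`-valued function of time. -/
def timeIntegral (h : ℝ≥0) (f : ℝ≥0 → ℝ≥0∞) : ℝ≥0∞ :=
  ∫⁻ s in Set.Ioc (0 : ℝ) (h : ℝ), f s.toNNReal

/-- `W` is a standard Brownian motion relative to the filtration `F`: it is a Brownian motion
(with `W 0 = 0` almost surely and almost surely continuous paths), it is adapted, and its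
increments after time `s` are independent of `F s`. -/
structure IsBrownianWrt (F : Filtration ℝ≥0 mΩ) (W : ℝ≥0 → Ω → ℝ) (μ : Measure Ω) : Prop where
  brownian : IsBrownianReal W μ
  adapted : Adapted F W
  indep_increment : ∀ s t : ℝ≥0, s ≤ t →
    Indep (MeasurableSpace.comap (fun ω => W t ω - W s ω) inferInstance) (F s) μ

/-- A process is stationary if all its time shifts have the same law, as random elements of the
path space with its product `σ`-algebra. -/
def IsStationary {E : Type*} [MeasurableSpace E] (Y : ℝ≥0 → Ω → E) (μ : Measure Ω) : Prop :=
  ∀ t : ℝ≥0, IdentDistrib (fun ω s => Y (t + s) ω) (fun ω s => Y s ω) μ μ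

/-- Bounded simple adapted integrands `∑ i < n, ξ i • 1_(time i, time (i + 1)]`,
where `ξ i` is bounded and `F (time i)`-measurable. -/
structure SimpleIntegrand (F : Filtration ℝ≥0 mΩ) where
  n : ℕ
  time : ℕ → ℝ≥0
  mono : Monotone time
  ξ : ℕ → Ω → ℝ
  meas : ∀ i, Measurable[F (time i)] (ξ i)
  bdd : ∀ i, ∃ C : ℝ, ∀ ω, |ξ i ω| ≤ C

namespace SimpleIntegrand

variable {F : Filtration ℝ≥0 mΩ}

/-- The value of a simple integrand at time `s`. -/
def eval (H : SimpleIntegrand F) (s : ℝ≥0) (ω : Ω) : ℝ :=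
  ∑ i ∈ Finset.range H.n,
    (Set.Ioc (H.time i) (H.time (i + 1))).indicator (fun _ => H.ξ i ω) s

/-- The elementary stochastic integral `∫_0^t H dW` of a simple integrand. -/
def integral (H : SimpleIntegrand F) (W : ℝ≥0 → Ω → ℝ) (t : ℝ≥0) (ω : Ω) : ℝ :=
  ∑ i ∈ Finset.range H.n,
    H.ξ i ω * (W (min (H.time (i + 1)) t) ω - W (min (H.time i) t) ω)

end SimpleIntegrand

/-- `dX = φ dW` in the sense of the (`L²`) Itô integral: `φ` is progressively measurable, and for
every `t` the increment `X t - X 0` is the limit in `L²(μ)` of elementary integrals `∫_0^t H_n dW`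
of simple integrands `H_n` that converge to `φ` in `L²` on `[0, t] × Ω`. -/
structure IsItoIntegral (F : Filtration ℝ≥0 mΩ) (W φ X : ℝ≥0 → Ω → ℝ) (μ : Measure Ω) :
    Prop where
  progressive : IsStronglyProgressive F φ
  aemeasurable : ∀ t, AEMeasurable (X t) μ
  limit : ∀ t : ℝ≥0, ∃ H : ℕ → SimpleIntegrand F,
    Tendsto (fun n => ∫⁻ ω, timeIntegral t (fun s => ‖(H n).eval s ω - φ s ω‖ₑ ^ 2) ∂μ)
      atTop (𝓝 0) ∧
    Tendsto (fun n => ∫⁻ ω, ‖X t ω - X 0 ω - (H n).integral W t ω‖ₑ ^ 2 ∂μ)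
      atTop (𝓝 0)

/-- The stochastic volatility model `dX = σ dW`, where `W` is a standard Brownian motion relative
to `F` and the volatility `σ` is a `[0, ∞)`-valued stationary process independent of `W`. -/
structure IsStochVolModel (F : Filtration ℝ≥0 mΩ) (σ : ℝ≥0 → Ω → ℝ≥0) (W X : ℝ≥0 → Ω → ℝ)
    (μ : Measure Ω) : Prop where
  brownian : IsBrownianWrt F W μ
  stationary : IsStationary σ μ
  indep : IndepFun (fun ω s => σ s ω) (fun ω s => W s ω) μ
  ito : IsItoIntegral F W (fun s ω => (σ s ω : ℝ)) X μ

/-- `(1/h) ∫_0^h (σ_s - σ_0)² ds → 0` in probability as `h ↓ 0`. -/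
def AssumptionA (σ : ℝ≥0 → Ω → ℝ≥0) (μ : Measure Ω) : Prop :=
  ∀ ε : ℝ≥0∞, 0 < ε → Tendsto (fun h : ℝ≥0 =>
    μ {ω | ε ≤ (h : ℝ≥0∞)⁻¹ * timeIntegral h (fun s => ‖(σ s ω : ℝ) - (σ 0 ω : ℝ)‖ₑ ^ 2)})
    (𝓝[>] 0) (𝓝 0)

/-- `E[σ_0²] < ∞`. -/
def AssumptionB (σ : ℝ≥0 → Ω → ℝ≥0) (μ : Measure Ω) : Prop :=
  ∫⁻ ω, (σ 0 ω : ℝ≥0∞) ^ 2 ∂μ < ∞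

/-- The scaling exponent
`A(q) = limsup_{h ↓ 0} log E[|X_{t+h} - X_t|^q] / log h`, as an extended real number, with
`log 0 = -∞` and `log ∞ = ∞`. -/
def scalingExponent (X : ℝ≥0 → Ω → ℝ) (μ : Measure Ω) (t : ℝ≥0) (q : ℝ) : EReal :=
  limsup (fun h : ℝ≥0 =>
    ENNReal.log (∫⁻ ω, ‖X (t + h) ω - X t ω‖ₑ ^ q ∂μ) / ((Real.log (h : ℝ) : ℝ) : EReal)) (𝓝[>] 0)

/-- Multi-scaling: the set of `q ≥ 1` with `-∞ < A(q) < q/2` has nonempty interior. -/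
def MultiScaling (X : ℝ≥0 → Ω → ℝ) (μ : Measure Ω) (t : ℝ≥0) : Prop :=
  (interior {q : ℝ | 1 ≤ q ∧ ⊥ < scalingExponent X μ t q ∧
    scalingExponent X μ t q < ((q / 2 : ℝ) : EReal)}).Nonempty

end StochVol

end

/-! Write `V_h = ∫_0^h σ²`. Conditionally on the volatility, the increment `X_{t+h} - X_t` is
centred Gaussian with variance distributed as `V_h`, hence `E|X_{t+h} - X_t|^q = c_q E[V_h^{q/2}]`
with `0 < c_q < ∞`. Everything then reduces to moments of `V_h`. Since `log h < 0`, a bound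
`E[V_h^{q/2}] ≤ C h^{q/2}` with `C` finite forces `A(q) ≥ q/2`. Jensen's inequality gives such a
bound in two cases: over `Ω` when `q ≤ 2`, with `C = E[σ_0²]^{q/2}`, and over time when `q ≥ 2`,
with `C = E[σ_0^q]`, provided this is finite. So any `q` with `A(q) < q/2` satisfies `q > 2` and
`E[σ_0^q] = ∞`. On the other hand `A(q) > -∞` makes `E[V_h^{q/2}]` finite for at least one `h`, and
splitting an increment of `X` into two consecutive ones propagates this to every `h`. Hence `p = q`
works.

The analytic work lies in the law of the increment (`map_increment`). Stationarity and (B) give the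
uniform integrability that upgrades (A) to convergence in mean (`tendsto_meanOscillation`), so `σ`
sampled on a fine grid is close to `σ` in `L²`. By the Itô isometry (`elementary_isometry`) the
elementary integrals of the sampled volatility converge to the increment of `X`. Their
characteristic functions are explicit because `σ` and `W` are independent, and involve only Riemann
sums of `σ²`, which converge in `L¹` to `V_h` (`tendsto_riemannSum`). -/

noncomputable section

namespace StochVol

variable {Ω : Type*} {mΩ : MeasurableSpace Ω}

/-! ### Gaussian sums with coefficients independent of the Brownian motion -/

section Conditioning

variable {μ : Measure Ω} {W : ℝ≥0 → Ω → ℝ}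

/-- The characteristic function of a deterministic linear combination of increments of a
Brownian motion. -/
lemma integral_exp_sum_increments [IsProbabilityMeasure μ] (hW : IsPreBrownianReal W μ)
    {τ : ℕ → ℝ≥0} (hτ : Monotone τ) {n : ℕ} (x : Fin n → ℝ) (u : ℝ) :
    ∫ w, Complex.exp (u * (∑ i, x i * w i : ℝ) * Complex.I)
      ∂(μ.map fun ω (i : Fin n) => W (τ (i + 1)) ω - W (τ i) ω)
      = Complex.exp (-(u ^ 2 / 2 * ∑ i : Fin n, x i ^ 2 * ((τ (i + 1) : ℝ) - τ i) : ℝ)) := by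
  have hind : iIndepFun (fun (i : Fin n) ω => W (τ (i + 1)) ω - W (τ i) ω) μ :=
    (hW.hasIndepIncrements.nat hτ).precomp (g := fun i : Fin n => (i : ℕ)) Fin.val_injective
  have hmeas : ∀ i : Fin n, AEMeasurable (fun ω => W (τ (i + 1)) ω - W (τ i) ω) μ := fun i =>
    (hW.aemeasurable _).sub (hW.aemeasurable _)
  rw [(iIndepFun_iff_map_fun_eq_pi_map hmeas).1 hind]
  have hprod : ∀ w : Fin n → ℝ, Complex.exp (u * (∑ i, x i * w i : ℝ) * Complex.I)
      = ∏ i, Complex.exp ((u * x i : ℝ) * (w i) * Complex.I) := by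
    intro w
    rw [← Complex.exp_sum]
    congr 1
    push_cast
    rw [Finset.mul_sum, Finset.sum_mul]
    exact Finset.sum_congr rfl fun i _ => by ring
  simp_rw [hprod]
  have : ∀ i : Fin n, IsProbabilityMeasure (μ.map fun ω => W (τ (i + 1)) ω - W (τ i) ω) :=
    fun i => Measure.isProbabilityMeasure_map (hmeas i)
  rw [integral_fintype_prod_eq_prod
    (fun i (y : ℝ) => Complex.exp ((u * x i : ℝ) * (y : ℂ) * Complex.I))]
  have hone : ∀ i : Fin n, ∫ y, Complex.exp ((u * x i : ℝ) * (y : ℂ) * Complex.I)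
      ∂(μ.map fun ω => W (τ (i + 1)) ω - W (τ i) ω)
      = Complex.exp (-(u ^ 2 / 2 * (x i ^ 2 * ((τ (i + 1) : ℝ) - τ i)) : ℝ)) := by
    intro i
    have hlaw := (hW.hasLaw_sub (τ (i + 1)) (τ i)).map_eq
    have hle : (τ i : ℝ) ≤ τ (i + 1) := NNReal.coe_le_coe.2 (hτ (Nat.le_succ _))
    change ∫ y, _ ∂(μ.map (W (τ (i + 1)) - W (τ i))) = _
    rw [hlaw, ← charFun_apply_real, charFun_gaussianReal]
    congr 1
    have : ((nndist (τ (i + 1)).1 (τ i).1 : ℝ≥0) : ℝ) = (τ (i + 1) : ℝ) - τ i := by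
      rw [coe_nndist, Real.dist_eq, abs_of_nonneg]
      · rfl
      · exact sub_nonneg.2 hle
    rw [this]
    push_cast
    ring
  rw [Finset.prod_congr rfl fun i _ => hone i, ← Complex.exp_sum]
  congr 1
  push_cast
  rw [Finset.mul_sum, ← Finset.sum_neg_distrib]

/-- If the random coefficients `S` are independent of the Brownian motion `W`, then conditionally
on `S` the elementary integral `∑ i, S i * (W (τ (i + 1)) - W (τ i))` is a centred Gaussian of
variance `∑ i, (S i) ^ 2 * (τ (i + 1) - τ i)`. -/
lemma integral_exp_sum_mul_increments [IsProbabilityMeasure μ] (hW : IsPreBrownianReal W μ)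
    {τ : ℕ → ℝ≥0} (hτ : Monotone τ) {n : ℕ} {S : Fin n → Ω → ℝ} (hS : ∀ i, Measurable (S i))
    (hind : IndepFun (fun ω i => S i ω) (fun ω s => W s ω) μ) (u : ℝ) :
    ∫ ω, Complex.exp (u * (∑ i, S i ω * (W (τ (i + 1)) ω - W (τ i) ω) : ℝ) * Complex.I) ∂μ
      = ∫ ω, Complex.exp
          (-(u ^ 2 / 2 * ∑ i : Fin n, S i ω ^ 2 * ((τ (i + 1) : ℝ) - τ i) : ℝ)) ∂μ := by
  have hSm : Measurable fun ω i => S i ω := measurable_pi_lambda _ hS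
  have hDm : AEMeasurable (fun ω (i : Fin n) => W (τ (i + 1)) ω - W (τ i) ω) μ :=
    aemeasurable_pi_lambda _ fun i => (hW.aemeasurable _).sub (hW.aemeasurable _)
  have hind' : IndepFun (fun ω i => S i ω)
      (fun ω (i : Fin n) => W (τ (i + 1)) ω - W (τ i) ω) μ :=
    hind.comp (φ := id) (ψ := fun (w : ℝ≥0 → ℝ) (i : Fin n) => w (τ (i + 1)) - w (τ i))
      measurable_id (by fun_prop)
  -- Independence makes the joint law of coefficients and increments a product, so Fubini allows the
  -- coefficients to be frozen while the increments are integrated out.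
  have hpair := hind'.map_prod_eq_prod_map_map hSm.aemeasurable hDm
  have hP1 : IsProbabilityMeasure (μ.map fun ω i => S i ω) :=
    Measure.isProbabilityMeasure_map hSm.aemeasurable
  have hP2 : IsProbabilityMeasure
      (μ.map fun ω (i : Fin n) => W (τ (i + 1)) ω - W (τ i) ω) :=
    Measure.isProbabilityMeasure_map hDm
  set G : (Fin n → ℝ) × (Fin n → ℝ) → ℂ :=
    fun p => Complex.exp (u * (∑ i, p.1 i * p.2 i : ℝ) * Complex.I) with hG
  have hGc : Continuous G := by fun_prop
  have hGn : ∀ p, ‖G p‖ = 1 := fun p => by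
    simp only [hG]
    rw [← Complex.ofReal_mul, Complex.norm_exp_ofReal_mul_I]
  have h1 : ∫ ω, G (fun i => S i ω, fun i => W (τ (i + 1)) ω - W (τ i) ω) ∂μ
      = ∫ p, G p ∂((μ.map fun ω i => S i ω).prod
          (μ.map fun ω (i : Fin n) => W (τ (i + 1)) ω - W (τ i) ω)) := by
    rw [← hpair, integral_map (hSm.aemeasurable.prodMk hDm) hGc.aestronglyMeasurable]
  have hint : Integrable G ((μ.map fun ω i => S i ω).prod
      (μ.map fun ω (i : Fin n) => W (τ (i + 1)) ω - W (τ i) ω)) :=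
    Integrable.of_bound hGc.aestronglyMeasurable 1 (ae_of_all _ fun p => (hGn p).le)
  change ∫ ω, G (fun i => S i ω, fun i => W (τ (i + 1)) ω - W (τ i) ω) ∂μ = _
  rw [h1, integral_prod _ hint]
  simp only [hG, integral_exp_sum_increments hW hτ]
  rw [integral_map hSm.aemeasurable]
  exact Continuous.aestronglyMeasurable (by fun_prop)

end Conditioning

/-! ### The Itô isometry for elementary integrands -/

section Isometry

variable {μ : Measure Ω} {W : ℝ≥0 → Ω → ℝ} {F : Filtration ℝ≥0 mΩ}

lemma enorm_sq_eq_ofReal (x : ℝ) : ‖x‖ₑ ^ 2 = ENNReal.ofReal (x ^ 2) := by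
  rw [Real.enorm_eq_ofReal_abs, ← ENNReal.ofReal_pow (abs_nonneg x), sq_abs]

namespace IsBrownianWrt

lemma hasLaw_increment (hW : IsBrownianWrt F W μ) {a b : ℝ≥0} (hab : a ≤ b) :
    HasLaw (fun ω => W b ω - W a ω) (gaussianReal 0 (b - a)) μ := by
  have h := hW.brownian.toIsPreBrownianReal.hasLaw_sub b a
  have : nndist b.1 a.1 = b - a := by
    rw [← NNReal.coe_inj, coe_nndist, Real.dist_eq, NNReal.coe_sub hab, abs_of_nonneg]
    · rfl
    · exact sub_nonneg.2 hab
  rwa [this] at h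

lemma memLp_increment (hW : IsBrownianWrt F W μ) {a b : ℝ≥0} (hab : a ≤ b) :
    MemLp (fun ω => W b ω - W a ω) 2 μ :=
  (hW.hasLaw_increment hab).hasGaussianLaw.memLp_two

lemma integral_increment (hW : IsBrownianWrt F W μ) {a b : ℝ≥0} (hab : a ≤ b) :
    ∫ ω, (W b ω - W a ω) ∂μ = 0 := by
  rw [(hW.hasLaw_increment hab).integral_eq, integral_id_gaussianReal]

lemma integral_increment_sq [IsProbabilityMeasure μ] (hW : IsBrownianWrt F W μ) {a b : ℝ≥0}
    (hab : a ≤ b) : ∫ ω, (W b ω - W a ω) ^ 2 ∂μ = b - a := by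
  have h := (hW.hasLaw_increment hab).variance_eq
  rw [variance_id_gaussianReal, variance_of_integral_eq_zero
    (hW.memLp_increment hab).aestronglyMeasurable.aemeasurable (hW.integral_increment hab)] at h
  rw [h, NNReal.coe_sub hab]

lemma indepFun_increment (hW : IsBrownianWrt F W μ) {c d : ℝ≥0} (hcd : c ≤ d) {U : Ω → ℝ}
    (hU : Measurable[F c] U) : IndepFun U (fun ω => W d ω - W c ω) μ := by
  rw [IndepFun_iff_Indep]
  exact indep_of_indep_of_le_left (hW.indep_increment c d hcd).symm hU.comap_le

lemma measurable_increment (hW : IsBrownianWrt F W μ) {a b c : ℝ≥0} (hac : a ≤ c) (hbc : b ≤ c) :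
    Measurable[F c] fun ω => W b ω - W a ω :=
  ((hW.adapted b).mono (F.mono hbc) le_rfl).sub ((hW.adapted a).mono (F.mono hac) le_rfl)

lemma integrable_mul_increment [IsProbabilityMeasure μ] (hW : IsBrownianWrt F W μ) {c d : ℝ≥0}
    (hcd : c ≤ d) {U : Ω → ℝ} (hU : Measurable[F c] U) (hUi : Integrable U μ) :
    Integrable (fun ω => U ω * (W d ω - W c ω)) μ :=
  (hW.indepFun_increment hcd hU).integrable_mul hUi
    ((hW.memLp_increment hcd).integrable one_le_two)

lemma integral_mul_increment [IsProbabilityMeasure μ] (hW : IsBrownianWrt F W μ) {c d : ℝ≥0}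
    (hcd : c ≤ d) {U : Ω → ℝ} (hU : Measurable[F c] U) :
    ∫ ω, U ω * (W d ω - W c ω) ∂μ = 0 := by
  have := (hW.indepFun_increment hcd hU).integral_mul_eq_mul_integral
    (hU.mono (F.le c) le_rfl).aestronglyMeasurable (hW.memLp_increment hcd).aestronglyMeasurable
  rw [hW.integral_increment hcd, mul_zero] at this
  exact this

lemma integral_mul_increment_sq [IsProbabilityMeasure μ] (hW : IsBrownianWrt F W μ) {c d : ℝ≥0}
    (hcd : c ≤ d) {U : Ω → ℝ} (hU : Measurable[F c] U) :
    ∫ ω, U ω * (W d ω - W c ω) ^ 2 ∂μ = (∫ ω, U ω ∂μ) * (d - c) := by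
  have := ((hW.indepFun_increment hcd hU).comp (φ := id) (ψ := fun x : ℝ => x ^ 2)
    measurable_id (by fun_prop)).integral_mul_eq_mul_integral
    (hU.mono (F.le c) le_rfl).aestronglyMeasurable
    ((hW.memLp_increment hcd).integrable_sq).aestronglyMeasurable
  rw [← hW.integral_increment_sq hcd]
  exact this

lemma integrable_mul_increment_sq [IsProbabilityMeasure μ] (hW : IsBrownianWrt F W μ) {c d : ℝ≥0}
    (hcd : c ≤ d) {U : Ω → ℝ} (hU : Measurable[F c] U) (hUi : Integrable U μ) :
    Integrable (fun ω => U ω * (W d ω - W c ω) ^ 2) μ :=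
  ((hW.indepFun_increment hcd hU).comp (φ := id) (ψ := fun x : ℝ => x ^ 2)
    measurable_id (by fun_prop)).integrable_mul hUi (hW.memLp_increment hcd).integrable_sq

lemma memLp_mul_increment [IsProbabilityMeasure μ] (hW : IsBrownianWrt F W μ) {c d : ℝ≥0}
    (hcd : c ≤ d) {U : Ω → ℝ} (hU : Measurable[F c] U) (hU2 : MemLp U 2 μ) :
    MemLp (fun ω => U ω * (W d ω - W c ω)) 2 μ := by
  refine (memLp_two_iff_integrable_sq (hU2.aestronglyMeasurable.mul
    (hW.memLp_increment hcd).aestronglyMeasurable)).2 ?_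
  simp only [Pi.mul_apply, mul_pow]
  exact hW.integrable_mul_increment_sq hcd (hU.pow_const 2) hU2.integrable_sq

/-- With `a ≤ c`, both increments are cut at the interval endpoints. Every product containing an
increment later than all its other factors has mean zero; what survives is the square of the
increment over the overlap, whose mean is the length of the overlap. -/
lemma integral_increment_mul_increment [IsProbabilityMeasure μ] (hW : IsBrownianWrt F W μ)
    {a b c d : ℝ≥0} (hab : a ≤ b) (hcd : c ≤ d) {ξ η : Ω → ℝ} (hξ : Measurable[F a] ξ)
    (hη : Measurable[F c] η) (hξ2 : MemLp ξ 2 μ) (hη2 : MemLp η 2 μ) :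
    ∫ ω, (ξ ω * (W b ω - W a ω)) * (η ω * (W d ω - W c ω)) ∂μ
      = (∫ ω, ξ ω * η ω ∂μ) * volume.real (Set.Ioc (a : ℝ) b ∩ Set.Ioc (c : ℝ) d) := by
  wlog hac : a ≤ c generalizing a b c d ξ η
  · have := this hcd hab hη hξ hη2 hξ2 (le_of_not_ge hac)
    rw [Set.inter_comm]
    simp only [mul_comm (ξ _) (η _)]
    rw [← this]
    exact integral_congr_ae (ae_of_all _ fun ω => mul_comm _ _)
  have hξc : Measurable[F c] ξ := hξ.mono (F.mono hac) le_rfl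
  have hξη : Measurable[F c] fun ω => ξ ω * η ω := hξc.mul hη
  have hξηi : Integrable (fun ω => ξ ω * η ω) μ := hξ2.integrable_mul hη2
  rcases le_total b c with hbc | hcb
  -- Disjoint intervals: everything except `W d - W c` is already `F c`-measurable.
  · have hempty : Set.Ioc (a : ℝ) b ∩ Set.Ioc (c : ℝ) d = ∅ := by
      ext s
      simp only [Set.mem_inter_iff, Set.mem_Ioc, Set.mem_empty_iff_false, iff_false]
      have : (b : ℝ) ≤ c := hbc
      rintro ⟨⟨_, h1⟩, h2, _⟩
      linarith
    rw [hempty, measureReal_empty, mul_zero]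
    rw [← hW.integral_mul_increment hcd (U := fun ω => ξ ω * (W b ω - W a ω) * η ω)
      ((hξc.mul (hW.measurable_increment (hac) hbc)).mul hη)]
    exact integral_congr_ae (ae_of_all _ fun ω => by ring)
  have hX := hW.memLp_mul_increment hac hξ hξ2
  have hU0 : Measurable[F c] fun ω => ξ ω * (W c ω - W a ω) * η ω :=
    (hξc.mul (hW.measurable_increment hac le_rfl)).mul hη
  have hU0i : Integrable (fun ω => ξ ω * (W c ω - W a ω) * η ω) μ := hX.integrable_mul hη2
  have hac' : (a : ℝ) ≤ c := hac
  have hinter : Set.Ioc (a : ℝ) b ∩ Set.Ioc (c : ℝ) d = Set.Ioc (c : ℝ) (min b d : ℝ≥0) := by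
    rw [Set.Ioc_inter_Ioc, NNReal.coe_min, sup_eq_right.2 hac']
  have hcm : c ≤ min b d := le_min hcb hcd
  rw [hinter, Real.volume_real_Ioc_of_le (by exact_mod_cast hcm)]
  rw [← hW.integral_mul_increment_sq hcm hξη]
  rcases le_total b d with hbd | hdb
  · rw [min_eq_left hbd]
    have hU1 : Measurable[F b] fun ω => ξ ω * (W b ω - W c ω) * η ω :=
      ((hξ.mono (F.mono hab) le_rfl).mul (hW.measurable_increment hcb le_rfl)).mul
        (hη.mono (F.mono hcb) le_rfl)
    have hU1i : Integrable (fun ω => ξ ω * (W b ω - W c ω) * η ω) μ :=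
      (hW.memLp_mul_increment hcb hξc hξ2).integrable_mul hη2
    -- The overlap is `(c, b]`. The outer two summands end in an increment independent of the factor
    -- before it and vanish in mean.
    have hsplit : ∀ ω, (ξ ω * (W b ω - W a ω)) * (η ω * (W d ω - W c ω))
        = ξ ω * (W c ω - W a ω) * η ω * (W d ω - W c ω)
          + (ξ ω * η ω * (W b ω - W c ω) ^ 2
          + ξ ω * (W b ω - W c ω) * η ω * (W d ω - W b ω)) := fun ω => by ring
    simp_rw [hsplit]
    have hadd := (hW.integrable_mul_increment_sq hcb hξη hξηi).add
      (hW.integrable_mul_increment hbd hU1 hU1i)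
    refine (integral_add (hW.integrable_mul_increment hcd hU0 hU0i) hadd).trans ?_
    simp only [Pi.add_apply]
    rw [integral_add (hW.integrable_mul_increment_sq hcb hξη hξηi)
        (hW.integrable_mul_increment hbd hU1 hU1i),
      hW.integral_mul_increment hcd hU0, hW.integral_mul_increment hbd hU1, zero_add, add_zero]
  · rw [min_eq_right hdb]
    have hU1 : Measurable[F d] fun ω => ξ ω * (η ω * (W d ω - W c ω)) :=
      (hξc.mono (F.mono hcd) le_rfl).mul
        ((hη.mono (F.mono hcd) le_rfl).mul (hW.measurable_increment hcd le_rfl))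
    have hU1i : Integrable (fun ω => ξ ω * (η ω * (W d ω - W c ω))) μ :=
      hξ2.integrable_mul (hW.memLp_mul_increment hcd hη hη2)
    have hsplit : ∀ ω, (ξ ω * (W b ω - W a ω)) * (η ω * (W d ω - W c ω))
        = ξ ω * (W c ω - W a ω) * η ω * (W d ω - W c ω)
          + (ξ ω * η ω * (W d ω - W c ω) ^ 2
          + ξ ω * (η ω * (W d ω - W c ω)) * (W b ω - W d ω)) := fun ω => by ring
    simp_rw [hsplit]
    have hadd := (hW.integrable_mul_increment_sq hcd hξη hξηi).add
      (hW.integrable_mul_increment hdb hU1 hU1i)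
    refine (integral_add (hW.integrable_mul_increment hcd hU0 hU0i) hadd).trans ?_
    simp only [Pi.add_apply]
    rw [integral_add (hW.integrable_mul_increment_sq hcd hξη hξηi)
        (hW.integrable_mul_increment hdb hU1 hU1i),
      hW.integral_mul_increment hcd hU0, hW.integral_mul_increment hdb hU1, zero_add, add_zero]

end IsBrownianWrt

/-- Pairs consisting of an integrand `ξ • 1_(a, b]` with square integrable `F a`-measurable `ξ`
and of its stochastic integral `ξ * (W b - W a)`. -/
def elementaryTerms (F : Filtration ℝ≥0 mΩ) (W : ℝ≥0 → Ω → ℝ) (μ : Measure Ω) :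
    Set ((ℝ → Ω → ℝ) × (Ω → ℝ)) :=
  {p | ∃ (a b : ℝ≥0) (ξ : Ω → ℝ), a ≤ b ∧ Measurable[F a] ξ ∧ MemLp ξ 2 μ ∧
    p = (fun s ω => (Set.Ioc (a : ℝ) b).indicator (fun _ => ξ ω) s,
      fun ω => ξ ω * (W b ω - W a ω))}

/-- The space of pairs `(f, ∫ f dW)` with `f` an elementary square integrable integrand. -/
def elementary (F : Filtration ℝ≥0 mΩ) (W : ℝ≥0 → Ω → ℝ) (μ : Measure Ω) :
    Submodule ℝ ((ℝ → Ω → ℝ) × (Ω → ℝ)) :=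
  Submodule.span ℝ (elementaryTerms F W μ)

/-- The Itô isometry for elementary integrands. -/
theorem elementary_isometry [IsProbabilityMeasure μ] (hW : IsBrownianWrt F W μ)
    {p : (ℝ → Ω → ℝ) × (Ω → ℝ)} (hp : p ∈ elementary F W μ) :
    ∫⁻ ω, ‖p.2 ω‖ₑ ^ 2 ∂μ = ∫⁻ ω, (∫⁻ s, ‖p.1 s ω‖ₑ ^ 2) ∂μ := by
  obtain ⟨n, k, g, rfl⟩ := Submodule.mem_span_set'.1 hp
  choose a b ζ hab hζ hζ2 hg using fun i => (g i).2
  -- The scalars of the linear combination are absorbed into the random coefficients.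
  set ξ : Fin n → Ω → ℝ := fun i ω => k i * ζ i ω with hξdef
  have hξ : ∀ i, Measurable[F (a i)] (ξ i) := fun i => (hζ i).const_mul _
  have hξ2 : ∀ i, MemLp (ξ i) 2 μ := fun i => (hζ2 i).const_mul _
  have e1 : ∀ s ω, (∑ i, k i • (g i : (ℝ → Ω → ℝ) × (Ω → ℝ))).1 s ω
      = ∑ i, (Set.Ioc (a i : ℝ) (b i)).indicator (fun _ => ξ i ω) s := by
    intro s ω
    simp only [Prod.fst_sum, Finset.sum_apply, hg, hξdef]
    refine Finset.sum_congr rfl fun i _ => ?_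
    by_cases hs : s ∈ Set.Ioc (a i : ℝ) (b i) <;> simp [hs]
  have e2 : ∀ ω, (∑ i, k i • (g i : (ℝ → Ω → ℝ) × (Ω → ℝ))).2 ω
      = ∑ i, ξ i ω * (W (b i) ω - W (a i) ω) := by
    intro ω
    simp only [Prod.snd_sum, Finset.sum_apply, hg, hξdef]
    exact Finset.sum_congr rfl fun i _ => by simp [mul_assoc]
  simp_rw [e1, e2, enorm_sq_eq_ofReal]
  have hZ : ∀ i, MemLp (fun ω => ξ i ω * (W (b i) ω - W (a i) ω)) 2 μ := fun i =>
    hW.memLp_mul_increment (hab i) (hξ i) (hξ2 i)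
  have hZs : MemLp (fun ω => ∑ i, ξ i ω * (W (b i) ω - W (a i) ω)) 2 μ :=
    memLp_finsetSum _ fun i _ => hZ i
  rw [← ofReal_integral_eq_lintegral_ofReal hZs.integrable_sq (ae_of_all _ fun _ => sq_nonneg _)]
  -- Both sides of the isometry expand into the same double sum of `E[ξ i ξ j]` weighted by the
  -- overlap lengths `ℓ i j`.
  set ℓ : Fin n → Fin n → ℝ := fun i j =>
    volume.real (Set.Ioc (a i : ℝ) (b i) ∩ Set.Ioc (a j : ℝ) (b j))
  have hℓ : ∀ ω, Integrable (fun s : ℝ =>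
        (∑ i, (Set.Ioc (a i : ℝ) (b i)).indicator (fun _ => ξ i ω) s) ^ 2) ∧
      ∫ s : ℝ, (∑ i, (Set.Ioc (a i : ℝ) (b i)).indicator (fun _ => ξ i ω) s) ^ 2
        = ∑ i, ∑ j, ξ i ω * ξ j ω * ℓ i j := by
    intro ω
    have hexp : ∀ s, (∑ i, (Set.Ioc (a i : ℝ) (b i)).indicator (fun _ => ξ i ω) s) ^ 2
        = ∑ i, ∑ j, (Set.Ioc (a i : ℝ) (b i) ∩ Set.Ioc (a j : ℝ) (b j)).indicator
          (fun _ => ξ i ω * ξ j ω) s := by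
      intro s
      rw [sq, Finset.sum_mul_sum]
      refine Finset.sum_congr rfl fun i _ => Finset.sum_congr rfl fun j _ => ?_
      rw [Set.inter_indicator_mul]
    have hI : ∀ i j, Integrable ((Set.Ioc (a i : ℝ) (b i) ∩ Set.Ioc (a j : ℝ) (b j)).indicator
          (fun _ => ξ i ω * ξ j ω)) volume := fun i j =>
      (integrable_indicator_iff (measurableSet_Ioc.inter measurableSet_Ioc)).2
        (integrableOn_const (ne_top_of_le_ne_top (by simp)
          (measure_mono Set.inter_subset_left)) enorm_ne_top)
    simp_rw [hexp]
    refine ⟨integrable_finsetSum _ fun i _ => integrable_finsetSum _ fun j _ => hI i j, ?_⟩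
    rw [integral_finsetSum _ fun i _ => integrable_finsetSum _ fun j _ => hI i j]
    refine Finset.sum_congr rfl fun i _ => ?_
    rw [integral_finsetSum _ fun j _ => hI i j]
    refine Finset.sum_congr rfl fun j _ => ?_
    rw [integral_indicator_const _ (measurableSet_Ioc.inter measurableSet_Ioc), smul_eq_mul,
      mul_comm]
  have hin : ∀ ω, ∫⁻ s : ℝ, ENNReal.ofReal
        ((∑ i, (Set.Ioc (a i : ℝ) (b i)).indicator (fun _ => ξ i ω) s) ^ 2)
      = ENNReal.ofReal (∑ i, ∑ j, ξ i ω * ξ j ω * ℓ i j) := by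
    intro ω
    rw [← ofReal_integral_eq_lintegral_ofReal (hℓ ω).1 (ae_of_all _ fun _ => sq_nonneg _),
      (hℓ ω).2]
  simp_rw [hin]
  have hnn : ∀ ω, 0 ≤ ∑ i, ∑ j, ξ i ω * ξ j ω * ℓ i j := fun ω =>
    (hℓ ω).2 ▸ integral_nonneg fun _ => sq_nonneg _
  have hξξ : ∀ i j, Integrable (fun ω => ξ i ω * ξ j ω * ℓ i j) μ := fun i j =>
    ((hξ2 i).integrable_mul (hξ2 j)).mul_const _
  rw [← ofReal_integral_eq_lintegral_ofReal
    (integrable_finsetSum _ fun i _ => integrable_finsetSum _ fun j _ => hξξ i j)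
    (ae_of_all _ hnn)]
  have hZZ : ∀ i j, Integrable (fun ω =>
      ξ i ω * (W (b i) ω - W (a i) ω) * (ξ j ω * (W (b j) ω - W (a j) ω))) μ := fun i j =>
    (hZ i).integrable_mul (hZ j)
  congr 1
  simp_rw [sq, Finset.sum_mul_sum]
  rw [integral_finsetSum _ fun i _ => integrable_finsetSum _ fun j _ => hZZ i j,
    integral_finsetSum _ fun i _ => integrable_finsetSum _ fun j _ => hξξ i j]
  refine Finset.sum_congr rfl fun i _ => ?_
  rw [integral_finsetSum _ fun j _ => hZZ i j,
    integral_finsetSum _ fun j _ => hξξ i j]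
  refine Finset.sum_congr rfl fun j _ => ?_
  rw [hW.integral_increment_mul_increment (hab i) (hab j) (hξ i) (hξ j) (hξ2 i) (hξ2 j),
    integral_mul_const]

end Isometry

/-! ### Measurability, stationarity and small-time oscillation of the volatility -/

section Volatility

variable {μ : Measure Ω} {F : Filtration ℝ≥0 mΩ} {σ : ℝ≥0 → Ω → ℝ≥0}

lemma measurable_uncurry_of_progressive
    (h : IsStronglyProgressive F (fun s ω => (σ s ω : ℝ))) :
    Measurable fun p : ℝ × Ω => σ p.1.toNNReal p.2 := by
  -- Progressive measurability only speaks of bounded time intervals, so time is stopped at `n` and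
  -- then `n → ∞`; the stopped values are eventually constant.
  have hfrozen : ∀ n : ℕ, Measurable fun p : ℝ≥0 × Ω => (σ (min p.1 n) p.2 : ℝ) := by
    intro n
    have h1 : Measurable fun p : Set.Iic (n : ℝ≥0) × Ω => (σ p.1 p.2 : ℝ) :=
      (h n).measurable.mono (sup_le_sup le_rfl (MeasurableSpace.comap_mono (F.le _))) le_rfl
    have h2 : Measurable fun p : ℝ≥0 × Ω =>
        ((⟨min p.1 n, Set.mem_Iic.2 (min_le_right _ _)⟩ : Set.Iic (n : ℝ≥0)), p.2) :=
      ((measurable_fst.min measurable_const).subtype_mk).prodMk measurable_snd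
    exact h1.comp h2
  have hall : Measurable fun p : ℝ≥0 × Ω => (σ p.1 p.2 : ℝ) := by
    refine measurable_of_tendsto_metrizable hfrozen (tendsto_pi_nhds.2 fun p => ?_)
    obtain ⟨N, hN⟩ := exists_nat_ge p.1
    refine tendsto_const_nhds.congr' ?_
    filter_upwards [eventually_ge_atTop N] with n hn
    rw [min_eq_left (hN.trans (by exact_mod_cast hn))]
  have h3 : Measurable fun p : ℝ≥0 × Ω => σ p.1 p.2 := by
    simpa using hall.real_toNNReal
  exact h3.comp ((measurable_real_toNNReal.comp measurable_fst).prodMk measurable_snd)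

lemma measurable_of_uncurry (hσ : Measurable fun p : ℝ × Ω => σ p.1.toNNReal p.2) (s : ℝ≥0) :
    Measurable (σ s) := by
  have := hσ.comp (measurable_prodMk_left (x := (s : ℝ)))
  simpa [Function.comp_def] using this

lemma IsStationary.lintegral_eq (hst : IsStationary σ μ) {n : ℕ} {g : (Fin n → ℝ≥0) → ℝ≥0∞}
    (hg : Measurable g) (t : ℝ≥0) (s : Fin n → ℝ≥0) :
    ∫⁻ ω, g (fun i => σ (t + s i) ω) ∂μ = ∫⁻ ω, g (fun i => σ (s i) ω) ∂μ :=
  ((hst t).comp (u := fun y : ℝ≥0 → ℝ≥0 => g fun i => y (s i))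
    (hg.comp (measurable_pi_lambda _ fun _ => measurable_pi_apply _))).lintegral_eq

lemma IsStationary.lintegral_comp_eq (hst : IsStationary σ μ) {g : ℝ≥0 → ℝ≥0∞}
    (hg : Measurable g) (t : ℝ≥0) :
    ∫⁻ ω, g (σ t ω) ∂μ = ∫⁻ ω, g (σ 0 ω) ∂μ := by
  simpa using hst.lintegral_eq (n := 1) (g := fun y => g (y 0)) (by fun_prop) t (fun _ => 0)

/-- The mean of `∫_0^d (σ_s - σ_0)² ds`. -/
def meanOscillation (σ : ℝ≥0 → Ω → ℝ≥0) (μ : Measure Ω) (d : ℝ≥0) : ℝ≥0∞ :=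
  ∫⁻ ω, timeIntegral d (fun s => ‖(σ s ω : ℝ) - (σ 0 ω : ℝ)‖ₑ ^ 2) ∂μ

lemma lintegral_setLIntegral_swap [SFinite μ] {Φ : ℝ × Ω → ℝ≥0∞} (hΦ : Measurable Φ) (S : Set ℝ) :
    ∫⁻ ω, (∫⁻ s in S, Φ (s, ω)) ∂μ = ∫⁻ s in S, ∫⁻ ω, Φ (s, ω) ∂μ :=
  lintegral_lintegral_swap (f := fun ω s => Φ (s, ω)) (hΦ.comp measurable_swap).aemeasurable

lemma lintegral_timeIntegral_comp [SFinite μ] (hst : IsStationary σ μ)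
    (hσ : Measurable fun p : ℝ × Ω => σ p.1.toNNReal p.2) {g : ℝ≥0 → ℝ≥0∞} (hg : Measurable g)
    (d : ℝ≥0) :
    ∫⁻ ω, timeIntegral d (fun s => g (σ s ω)) ∂μ = d * ∫⁻ ω, g (σ 0 ω) ∂μ := by
  refine (lintegral_setLIntegral_swap (hg.comp hσ) (Set.Ioc (0 : ℝ) d)).trans ?_
  simp only [Function.comp_apply]
  simp_rw [hst.lintegral_comp_eq hg]
  rw [lintegral_const, Measure.restrict_apply_univ, Real.volume_Ioc, sub_zero, mul_comm,
    ENNReal.ofReal_coe_nnreal]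

lemma measurable_sub_sq (hσ : Measurable fun p : ℝ × Ω => σ p.1.toNNReal p.2) (a : ℝ≥0) :
    Measurable fun p : ℝ × Ω => ‖(σ p.1.toNNReal p.2 : ℝ) - (σ a p.2 : ℝ)‖ₑ ^ 2 := by
  have h1 := hσ.coe_nnreal_real
  have h2 := ((measurable_of_uncurry hσ a).comp (measurable_snd : Measurable (Prod.snd : ℝ × Ω → Ω))).coe_nnreal_real
  exact (h1.sub h2).enorm.pow_const 2

/-- After translating time by `a`, only the law of the pair `(σ_{a+s}, σ_a)` matters, and
stationarity identifies it with that of `(σ_s, σ_0)`. -/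
lemma lintegral_Ioc_sub_sq [SFinite μ] (hst : IsStationary σ μ)
    (hσ : Measurable fun p : ℝ × Ω => σ p.1.toNNReal p.2) (a d : ℝ≥0) :
    ∫⁻ ω, (∫⁻ s in Set.Ioc (a : ℝ) (a + d : ℝ≥0),
      ‖(σ s.toNNReal ω : ℝ) - (σ a ω : ℝ)‖ₑ ^ 2) ∂μ = meanOscillation σ μ d := by
  refine (lintegral_setLIntegral_swap (measurable_sub_sq hσ a) _).trans
    (Eq.trans ?_ (lintegral_setLIntegral_swap (measurable_sub_sq hσ 0) (Set.Ioc (0 : ℝ) d)).symm)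
  have hpre : (fun s : ℝ => s + a) ⁻¹' Set.Ioc (a : ℝ) (a + d : ℝ≥0) = Set.Ioc (0 : ℝ) d := by
    rw [Set.preimage_add_const_Ioc]
    simp
  rw [← (measurePreserving_add_right volume (a : ℝ)).setLIntegral_comp_preimage_emb
    (measurableEmbedding_addRight _), hpre]
  refine setLIntegral_congr_fun measurableSet_Ioc fun s hs => ?_
  have hadd : (s + a).toNNReal = a + s.toNNReal := by
    rw [Real.toNNReal_add hs.1.le a.coe_nonneg, add_comm]
    simp
  have := hst.lintegral_eq (n := 2)
    (g := fun y => ‖(y 0 : ℝ) - (y 1 : ℝ)‖ₑ ^ 2) (by fun_prop) a ![s.toNNReal, 0]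
  simpa [hadd] using this

/-- If `|x - y| > M`, then `|x - y| ≤ max x y ≤ M + (max x y - M)⁺`. The subtractions in `ℝ≥0` are
truncated, so the last two terms are the excesses over level `M`. This separates a bounded part,
controlled by convergence in probability, from tails controlled by uniform integrability. -/
lemma enorm_sub_sq_le_truncate (x y M : ℝ≥0) :
    ‖(x : ℝ) - y‖ₑ ^ 2 ≤ 3 * min (‖(x : ℝ) - y‖ₑ ^ 2) ((M : ℝ≥0∞) ^ 2)
      + 3 * ((x - M : ℝ≥0) : ℝ≥0∞) ^ 2 + 3 * ((y - M : ℝ≥0) : ℝ≥0∞) ^ 2 := by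
  have hx : ((x - M : ℝ≥0) : ℝ) = max ((x : ℝ) - M) 0 := NNReal.coe_sub_def
  have hy : ((y - M : ℝ≥0) : ℝ) = max ((y : ℝ) - M) 0 := NNReal.coe_sub_def
  have hreal : ((x : ℝ) - y) ^ 2 ≤ 3 * min (((x : ℝ) - y) ^ 2) ((M : ℝ) ^ 2)
      + 3 * ((x - M : ℝ≥0) : ℝ) ^ 2 + 3 * ((y - M : ℝ≥0) : ℝ) ^ 2 := by
    rw [hx, hy]
    have hx0 : (0 : ℝ) ≤ x := x.2
    have hy0 : (0 : ℝ) ≤ y := y.2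
    have hM0 : (0 : ℝ) ≤ M := M.2
    rcases le_total (((x : ℝ) - y) ^ 2) ((M : ℝ) ^ 2) with h | h
    · rw [min_eq_left h]
      nlinarith [sq_nonneg ((x : ℝ) - y), sq_nonneg (max ((x : ℝ) - M) 0),
        sq_nonneg (max ((y : ℝ) - M) 0)]
    · rw [min_eq_right h]
      have key : ∀ a b : ℝ, 0 ≤ a → 0 ≤ b → b ≤ a → (a - b) ^ 2 ≤ 3 * (M : ℝ) ^ 2
          + 3 * (max (a - M) 0) ^ 2 := by
        intro a b ha hb hba
        have h1 : a - b ≤ M + max (a - M) 0 := by linarith [le_max_left (a - M) 0]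
        have h2 : (0 : ℝ) ≤ max (a - M) 0 := le_max_right _ _
        have h3 : (a - b) ^ 2 ≤ (M + max (a - M) 0) ^ 2 :=
          pow_le_pow_left₀ (by linarith) h1 2
        nlinarith [sq_nonneg ((M : ℝ) - max (a - M) 0)]
      rcases le_total (y : ℝ) x with hxy | hxy
      · nlinarith [key x y hx0 hy0 hxy, sq_nonneg (max ((y : ℝ) - M) 0)]
      · nlinarith [key y x hy0 hx0 hxy, sq_nonneg (max ((x : ℝ) - M) 0)]
  have hc : ∀ z : ℝ≥0, (z : ℝ≥0∞) ^ 2 = ENNReal.ofReal ((z : ℝ) ^ 2) := fun z => by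
    rw [ENNReal.ofReal_pow (NNReal.coe_nonneg z), ENNReal.ofReal_coe_nnreal]
  have h3 : (3 : ℝ≥0∞) = ENNReal.ofReal 3 := by simp
  rw [enorm_sq_eq_ofReal, hc, hc, hc, ← ENNReal.ofReal_min, h3,
    ← ENNReal.ofReal_mul (by norm_num), ← ENNReal.ofReal_mul (by norm_num),
    ← ENNReal.ofReal_mul (by norm_num), ← ENNReal.ofReal_add (by positivity) (by positivity),
    ← ENNReal.ofReal_add (by positivity) (by positivity)]
  exact ENNReal.ofReal_le_ofReal hreal

lemma tendsto_lintegral_truncate (hm : Measurable (σ 0)) (hB : AssumptionB σ μ) :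
    Tendsto (fun M : ℕ => ∫⁻ ω, ((σ 0 ω - M : ℝ≥0) : ℝ≥0∞) ^ 2 ∂μ) atTop (𝓝 0) := by
  have h := tendsto_lintegral_of_dominated_convergence (μ := μ)
    (F := fun (M : ℕ) ω => ((σ 0 ω - M : ℝ≥0) : ℝ≥0∞) ^ 2) (f := fun _ => 0)
    (fun ω => (σ 0 ω : ℝ≥0∞) ^ 2)
    (fun M => ((hm.sub_const _).coe_nnreal_ennreal.pow_const 2))
    (fun M => ae_of_all _ fun ω => by
      have : ((σ 0 ω - M : ℝ≥0) : ℝ≥0∞) ≤ σ 0 ω := by exact_mod_cast tsub_le_self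
      exact pow_le_pow_left' this 2) hB.ne
    (ae_of_all _ fun ω => by
      obtain ⟨N, hN⟩ := exists_nat_ge (σ 0 ω)
      refine tendsto_const_nhds.congr' ?_
      filter_upwards [eventually_ge_atTop N] with n hn
      rw [tsub_eq_zero_of_le (hN.trans (by exact_mod_cast hn))]
      simp)
  simpa using h

lemma tendsto_zero_of_eventually_le_mul {α : Type*} {l : Filter α} {f : α → ℝ≥0∞} {C : ℝ≥0∞}
    (hC0 : C ≠ 0) (hC : C ≠ ∞) (h : ∀ ε, 0 < ε → ∀ᶠ x in l, f x ≤ C * ε) :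
    Tendsto f l (𝓝 0) := by
  rw [ENNReal.tendsto_nhds_zero]
  intro ε hε
  have := h (ε / C) (ENNReal.div_pos hε.ne' hC)
  rwa [ENNReal.mul_div_cancel hC0 hC] at this

/-- Under stationarity, assumption (A) and `E[σ_0²] < ∞` the convergence in (A) holds in `L¹`. -/
lemma tendsto_meanOscillation [IsProbabilityMeasure μ] (hst : IsStationary σ μ)
    (hσ : Measurable fun p : ℝ × Ω => σ p.1.toNNReal p.2)
    (hA : AssumptionA σ μ) (hB : AssumptionB σ μ) :
    Tendsto (fun d : ℝ≥0 => (d : ℝ≥0∞)⁻¹ * meanOscillation σ μ d) (𝓝[>] 0) (𝓝 0) := by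
  -- The constant is `3 * 2 + 3 + 3`: the bounded part contributes `ε` twice, each tail once. The
  -- truncation level `M` is fixed before `d` tends to zero.
  refine tendsto_zero_of_eventually_le_mul (C := 12) (by norm_num) (by norm_num) fun ε hε => ?_
  obtain ⟨M, hM⟩ := ((ENNReal.tendsto_nhds_zero.1
    (tendsto_lintegral_truncate (measurable_of_uncurry hσ 0) hB)) ε hε).exists
  have hA' : Tendsto (fun h : ℝ≥0 => (M : ℝ≥0∞) ^ 2 *
      μ {ω | ε ≤ (h : ℝ≥0∞)⁻¹ * timeIntegral h (fun s => ‖(σ s ω : ℝ) - (σ 0 ω : ℝ)‖ₑ ^ 2)})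
      (𝓝[>] 0) (𝓝 0) := by
    simpa using ENNReal.Tendsto.const_mul (hA ε hε) (Or.inr (by simp))
  filter_upwards [ENNReal.tendsto_nhds_zero.1 hA' ε hε, self_mem_nhdsWithin] with d hd hd0
  have hd0' : (d : ℝ≥0∞) ≠ 0 := by simpa using (ne_of_gt hd0)
  set D : Ω → ℝ≥0∞ := fun ω =>
    timeIntegral d (fun s => ‖(σ s ω : ℝ) - (σ 0 ω : ℝ)‖ₑ ^ 2)
  have hDm : Measurable D := (measurable_sub_sq hσ 0).lintegral_prod_left'
  have hmt : Measurable fun x : ℝ≥0 => ((x - M : ℝ≥0) : ℝ≥0∞) ^ 2 := by fun_prop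
  -- The truncation inequality integrated over time, using that the integral of a minimum is at most
  -- the minimum of the integrals.
  have hstep : ∀ ω, D ω ≤ 3 * min (D ω) (d * (M : ℝ≥0∞) ^ 2)
      + 3 * timeIntegral d (fun s => ((σ s ω - M : ℝ≥0) : ℝ≥0∞) ^ 2)
      + 3 * (d * ((σ 0 ω - M : ℝ≥0) : ℝ≥0∞) ^ 2) := by
    intro ω
    have hσω : Measurable fun s : ℝ => σ s.toNNReal ω := hσ.comp measurable_prodMk_right
    have hω1 : Measurable fun s : ℝ =>
        3 * min (‖(σ s.toNNReal ω : ℝ) - (σ 0 ω : ℝ)‖ₑ ^ 2) ((M : ℝ≥0∞) ^ 2) :=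
      (((hσω.coe_nnreal_real.sub_const _).enorm.pow_const 2).min measurable_const).const_mul 3
    have hω2 : Measurable fun s : ℝ => ((σ s.toNNReal ω - M : ℝ≥0) : ℝ≥0∞) ^ 2 :=
      hmt.comp hσω
    calc D ω ≤ ∫⁻ s in Set.Ioc (0 : ℝ) d,
          (3 * min (‖(σ s.toNNReal ω : ℝ) - (σ 0 ω : ℝ)‖ₑ ^ 2) ((M : ℝ≥0∞) ^ 2)
          + 3 * ((σ s.toNNReal ω - M : ℝ≥0) : ℝ≥0∞) ^ 2
          + 3 * ((σ 0 ω - M : ℝ≥0) : ℝ≥0∞) ^ 2) :=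
          lintegral_mono fun s => by
            simpa using enorm_sub_sq_le_truncate (σ s.toNNReal ω) (σ 0 ω) M
      _ = (∫⁻ s in Set.Ioc (0 : ℝ) d,
            3 * min (‖(σ s.toNNReal ω : ℝ) - (σ 0 ω : ℝ)‖ₑ ^ 2) ((M : ℝ≥0∞) ^ 2))
          + 3 * timeIntegral d (fun s => ((σ s ω - M : ℝ≥0) : ℝ≥0∞) ^ 2)
          + 3 * (d * ((σ 0 ω - M : ℝ≥0) : ℝ≥0∞) ^ 2) := by
          rw [lintegral_add_right _ measurable_const, lintegral_add_left hω1,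
            lintegral_const_mul _ hω2, lintegral_const, Measure.restrict_apply_univ,
            Real.volume_Ioc, sub_zero, ENNReal.ofReal_coe_nnreal]
          unfold timeIntegral
          ring
      _ ≤ _ := by
          gcongr
          rw [lintegral_const_mul' _ _ (by norm_num)]
          gcongr
          refine le_min (lintegral_mono fun s => min_le_left _ _) ?_
          refine (lintegral_mono fun s => min_le_right _ _).trans ?_
          rw [lintegral_const, Measure.restrict_apply_univ, Real.volume_Ioc, sub_zero,
            ENNReal.ofReal_coe_nnreal, mul_comm]
  -- Off the exceptional event of (A) the time average is below `ε`; on it the truncation bound `M ^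
  -- 2` is used.
  have hmin2 : ∀ ω, min (D ω) (d * (M : ℝ≥0∞) ^ 2)
      ≤ d * (ε + {ω | ε ≤ (d : ℝ≥0∞)⁻¹ * D ω}.indicator (fun _ => (M : ℝ≥0∞) ^ 2) ω) := by
    intro ω
    by_cases hω : ε ≤ (d : ℝ≥0∞)⁻¹ * D ω
    · rw [Set.indicator_of_mem (by exact hω)]
      exact (min_le_right _ _).trans (by gcongr; exact le_add_self)
    · rw [Set.indicator_of_notMem (by exact hω), add_zero]
      refine (min_le_left _ _).trans ?_
      rw [← ENNReal.mul_le_mul_iff_right (ENNReal.inv_ne_zero.2 ENNReal.coe_ne_top)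
        (ENNReal.inv_ne_top.2 hd0'), ← mul_assoc, ENNReal.inv_mul_cancel hd0' ENNReal.coe_ne_top,
        one_mul]
      exact (not_le.1 hω).le
  have hset : MeasurableSet {ω | ε ≤ (d : ℝ≥0∞)⁻¹ * D ω} :=
    measurableSet_le measurable_const (hDm.const_mul _)
  have hm0 : Measurable fun ω => ((σ 0 ω - M : ℝ≥0) : ℝ≥0∞) ^ 2 :=
    hmt.comp (measurable_of_uncurry hσ 0)
  have htm : Measurable fun ω => timeIntegral d (fun s => ((σ s ω - M : ℝ≥0) : ℝ≥0∞) ^ 2) :=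
    (hmt.comp hσ).lintegral_prod_left'
  have htotal : meanOscillation σ μ d ≤ d * (12 * ε) := by
    calc meanOscillation σ μ d = ∫⁻ ω, D ω ∂μ := rfl
      _ ≤ ∫⁻ ω, (3 * (d * (ε + {ω | ε ≤ (d : ℝ≥0∞)⁻¹ * D ω}.indicator
            (fun _ => (M : ℝ≥0∞) ^ 2) ω))
          + 3 * timeIntegral d (fun s => ((σ s ω - M : ℝ≥0) : ℝ≥0∞) ^ 2)
          + 3 * (d * ((σ 0 ω - M : ℝ≥0) : ℝ≥0∞) ^ 2)) ∂μ :=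
          lintegral_mono fun ω => (hstep ω).trans (by gcongr; exact hmin2 ω)
      _ = 3 * (d * (ε + (M : ℝ≥0∞) ^ 2 * μ {ω | ε ≤ (d : ℝ≥0∞)⁻¹ * D ω}))
          + 3 * (d * ∫⁻ ω, ((σ 0 ω - M : ℝ≥0) : ℝ≥0∞) ^ 2 ∂μ)
          + 3 * (d * ∫⁻ ω, ((σ 0 ω - M : ℝ≥0) : ℝ≥0∞) ^ 2 ∂μ) := by
          have hi : Measurable ({ω | ε ≤ (d : ℝ≥0∞)⁻¹ * D ω}.indicator
              (fun _ => (M : ℝ≥0∞) ^ 2)) := measurable_const.indicator hset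
          rw [lintegral_add_right _ ((hm0.const_mul _).const_mul _),
            lintegral_add_right _ (htm.const_mul _),
            lintegral_const_mul _ ((hi.const_add _).const_mul _),
            lintegral_const_mul _ (hi.const_add _), lintegral_const_mul _ htm,
            lintegral_const_mul _ (hm0.const_mul _), lintegral_const_mul _ hm0,
            lintegral_add_left measurable_const, lintegral_const, measure_univ, mul_one,
            lintegral_indicator_const hset, lintegral_timeIntegral_comp hst hσ hmt]
      _ ≤ 3 * (d * (ε + ε)) + 3 * (d * ε) + 3 * (d * ε) := by gcongr
      _ = d * (12 * ε) := by ring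
  calc (d : ℝ≥0∞)⁻¹ * meanOscillation σ μ d ≤ (d : ℝ≥0∞)⁻¹ * (d * (12 * ε)) := by gcongr
    _ = 12 * ε := by
      rw [← mul_assoc, ENNReal.inv_mul_cancel hd0' ENNReal.coe_ne_top, one_mul]

end Volatility

/-! ### Step functions and regular grids -/

section StepFunctions

/-- The step function equal to `x i` on `(τ i, τ (i + 1)]` for `i < n`, and zero elsewhere. -/
def stepFun (τ : ℕ → ℝ≥0) (n : ℕ) (x : ℕ → ℝ) (s : ℝ) : ℝ :=
  ∑ i ∈ Finset.range n, (Set.Ioc (τ i : ℝ) (τ (i + 1))).indicator (fun _ => x i) s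

variable {τ : ℕ → ℝ≥0}

lemma stepFun_of_mem (hτ : Monotone τ) {n i : ℕ} (hi : i < n) (x : ℕ → ℝ) {s : ℝ}
    (hs : s ∈ Set.Ioc (τ i : ℝ) (τ (i + 1))) : stepFun τ n x s = x i := by
  unfold stepFun
  rw [Finset.sum_eq_single i]
  · rw [Set.indicator_of_mem hs]
  · intro j _ hji
    refine Set.indicator_of_notMem (fun hj => ?_) _
    rcases lt_or_gt_of_ne hji with h | h
    · have : (τ (j + 1) : ℝ) ≤ τ i := NNReal.coe_le_coe.2 (hτ h)
      linarith [hj.2, hs.1]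
    · have : (τ (i + 1) : ℝ) ≤ τ j := NNReal.coe_le_coe.2 (hτ h)
      linarith [hj.1, hs.2]
  · intro h
    exact absurd (Finset.mem_range.2 hi) h

lemma stepFun_of_notMem (hτ : Monotone τ) {n : ℕ} (x : ℕ → ℝ) {s : ℝ}
    (hs : s ∉ Set.Ioc (τ 0 : ℝ) (τ n)) : stepFun τ n x s = 0 := by
  refine Finset.sum_eq_zero fun i hi => Set.indicator_of_notMem (fun h => hs ?_) _
  exact ⟨(NNReal.coe_le_coe.2 (hτ (Nat.zero_le i))).trans_lt h.1,
    h.2.trans (NNReal.coe_le_coe.2 (hτ (Finset.mem_range.1 hi)))⟩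

lemma lintegral_Ioc_eq_sum (hτ : Monotone τ) (n : ℕ) (f : ℝ → ℝ≥0∞) :
    ∫⁻ s in Set.Ioc (τ 0 : ℝ) (τ n), f s
      = ∑ i ∈ Finset.range n, ∫⁻ s in Set.Ioc (τ i : ℝ) (τ (i + 1)), f s := by
  induction n with
  | zero => simp
  | succ n ih =>
    rw [Finset.sum_range_succ, ← ih, ← lintegral_union measurableSet_Ioc
      (Set.Ioc_disjoint_Ioc_of_le le_rfl), Set.Ioc_union_Ioc_eq_Ioc
      (NNReal.coe_le_coe.2 (hτ (Nat.zero_le n))) (NNReal.coe_le_coe.2 (hτ n.le_succ))]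

end StepFunctions

/-- The regular grid of mesh `d` started at `t`. -/
def grid (t d : ℝ≥0) (i : ℕ) : ℝ≥0 := t + i * d

lemma grid_zero (t d : ℝ≥0) : grid t d 0 = t := by simp [grid]

lemma grid_succ (t d : ℝ≥0) (i : ℕ) : grid t d (i + 1) = grid t d i + d := by
  simp only [grid]; push_cast; ring

lemma grid_mono (t d : ℝ≥0) : Monotone (grid t d) :=
  monotone_nat_of_le_succ fun i => by rw [grid_succ]; exact le_self_add

/-- The mesh of the grid dividing an interval of length `h` into `n + 1` pieces. -/
def mesh (h : ℝ≥0) (n : ℕ) : ℝ≥0 := h / (n + 1)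

lemma succ_mul_mesh (h : ℝ≥0) (n : ℕ) : ((n : ℝ≥0) + 1) * mesh h n = h := by
  unfold mesh
  field_simp

lemma grid_mesh (t h : ℝ≥0) (n : ℕ) : grid t (mesh h n) (n + 1) = t + h := by
  simp only [grid]
  push_cast
  rw [succ_mul_mesh]

lemma mesh_pos {h : ℝ≥0} (hh : 0 < h) (n : ℕ) : 0 < mesh h n := by unfold mesh; positivity

lemma tendsto_mesh {h : ℝ≥0} (hh : 0 < h) : Tendsto (mesh h) atTop (𝓝[>] 0) := by
  refine tendsto_nhdsWithin_iff.2 ⟨?_, Eventually.of_forall fun n => mesh_pos hh n⟩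
  rw [← NNReal.tendsto_coe]
  have := (tendsto_one_div_add_atTop_nhds_zero_nat (𝕜 := ℝ)).const_mul (h : ℝ)
  simpa [mesh, div_eq_mul_inv] using this

/-! ### Grid approximation of the volatility and of the integrated variance -/

section Approximation

variable {μ : Measure Ω} {σ : ℝ≥0 → Ω → ℝ≥0}

lemma tendsto_succ_mul_meanOscillation [IsProbabilityMeasure μ] (hst : IsStationary σ μ)
    (hσ : Measurable fun p : ℝ × Ω => σ p.1.toNNReal p.2)
    (hA : AssumptionA σ μ) (hB : AssumptionB σ μ) {h : ℝ≥0} (hh : 0 < h) :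
    Tendsto (fun n : ℕ => ((n : ℝ≥0∞) + 1) * meanOscillation σ μ (mesh h n)) atTop (𝓝 0) := by
  have h1 := (tendsto_meanOscillation hst hσ hA hB).comp (tendsto_mesh hh)
  have h2 := ENNReal.Tendsto.const_mul (a := (h : ℝ≥0∞)) h1 (Or.inr ENNReal.coe_ne_top)
  rw [mul_zero] at h2
  refine h2.congr fun n => ?_
  have hm := (mesh_pos hh n).ne'
  have : (h : ℝ≥0∞) = ((n : ℝ≥0∞) + 1) * mesh h n := by
    rw [← ENNReal.coe_natCast, ← ENNReal.coe_one, ← ENNReal.coe_add, ← ENNReal.coe_mul,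
      succ_mul_mesh]
  rw [Function.comp_apply, this, mul_assoc, ← mul_assoc _ _ (meanOscillation σ μ _),
    ENNReal.mul_inv_cancel (by simpa using hm) ENNReal.coe_ne_top, one_mul]

/-- Sampling the volatility on the grid dividing `(t, t + h]` into `n + 1` pieces approximates it in
`L²`. -/
lemma lintegral_stepFun_sub_sq [SFinite μ] (hst : IsStationary σ μ)
    (hσ : Measurable fun p : ℝ × Ω => σ p.1.toNNReal p.2) (t h : ℝ≥0) (n : ℕ) :
    ∫⁻ ω, (∫⁻ s in Set.Ioc (t : ℝ) (t + h : ℝ≥0),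
      ‖stepFun (grid t (mesh h n)) (n + 1) (fun i => σ (grid t (mesh h n) i) ω) s
        - σ s.toNNReal ω‖ₑ ^ 2) ∂μ = ((n : ℝ≥0∞) + 1) * meanOscillation σ μ (mesh h n) := by
  set τ := grid t (mesh h n)
  have hτ : Monotone τ := grid_mono _ _
  have e : ∀ ω, (∫⁻ s in Set.Ioc (t : ℝ) (t + h : ℝ≥0),
      ‖stepFun τ (n + 1) (fun i => σ (τ i) ω) s - σ s.toNNReal ω‖ₑ ^ 2)
      = ∑ i ∈ Finset.range (n + 1), ∫⁻ s in Set.Ioc (τ i : ℝ) (τ i + mesh h n : ℝ≥0),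
        ‖(σ s.toNNReal ω : ℝ) - σ (τ i) ω‖ₑ ^ 2 := by
    intro ω
    rw [← grid_mesh t h n]
    nth_rewrite 1 [← grid_zero t (mesh h n)]
    rw [lintegral_Ioc_eq_sum hτ]
    refine Finset.sum_congr rfl fun i hi => ?_
    rw [← grid_succ]
    refine setLIntegral_congr_fun measurableSet_Ioc fun s hs => ?_
    rw [stepFun_of_mem hτ (Finset.mem_range.1 hi) _ hs, enorm_sub_rev]
  simp_rw [e]
  rw [lintegral_finsetSum _ fun i _ => (measurable_sub_sq hσ (τ i)).lintegral_prod_left']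
  simp_rw [lintegral_Ioc_sub_sq hst hσ]
  simp

/-- Young's inequality with weight `δ`. Two versions are needed because either argument may carry
the `δ`-term: when sampled and true volatility are compared in both directions, that term can always
be placed on the true volatility, whose integral is `intVar`. -/
lemma coe_sq_le_add (a b δ : ℝ≥0) (hδ : 0 < δ) :
    (a : ℝ≥0∞) ^ 2 ≤ (b : ℝ≥0∞) ^ 2
        + ((1 + (δ⁻¹ : ℝ≥0)) * ‖(a : ℝ) - b‖ₑ ^ 2 + δ * (a : ℝ≥0∞) ^ 2) ∧
      (a : ℝ≥0∞) ^ 2 ≤ (b : ℝ≥0∞) ^ 2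
        + ((1 + (δ⁻¹ : ℝ≥0)) * ‖(a : ℝ) - b‖ₑ ^ 2 + δ * (b : ℝ≥0∞) ^ 2) := by
  have hδ' : (0 : ℝ) < δ := hδ
  have hc : ∀ z : ℝ≥0, (z : ℝ≥0∞) ^ 2 = ENNReal.ofReal ((z : ℝ) ^ 2) := fun z => by
    rw [ENNReal.ofReal_pow (NNReal.coe_nonneg z), ENNReal.ofReal_coe_nnreal]
  have hd : (1 + ((δ⁻¹ : ℝ≥0) : ℝ≥0∞)) = ENNReal.ofReal (1 + (δ : ℝ)⁻¹) := by
    rw [ENNReal.ofReal_add (by norm_num) (by positivity), ENNReal.ofReal_one, ← NNReal.coe_inv,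
      ENNReal.ofReal_coe_nnreal]
  have hcauchy : ∀ x y : ℝ, 2 * (x * y) ≤ δ * x ^ 2 + (δ : ℝ)⁻¹ * y ^ 2 := by
    intro x y
    have h1 : 0 ≤ (δ : ℝ)⁻¹ * (δ * x - y) ^ 2 := by positivity
    have h2 : (δ : ℝ)⁻¹ * (δ * x - y) ^ 2 = δ * x ^ 2 + (δ : ℝ)⁻¹ * y ^ 2 - 2 * (x * y) := by
      field_simp
      ring
    linarith
  rw [enorm_sq_eq_ofReal, hc, hc, hd, ← ENNReal.ofReal_mul (by positivity),
    ← ENNReal.ofReal_coe_nnreal (p := δ), ← ENNReal.ofReal_mul (by positivity),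
    ← ENNReal.ofReal_mul (by positivity),
    ← ENNReal.ofReal_add (by positivity) (by positivity),
    ← ENNReal.ofReal_add (by positivity) (by positivity),
    ← ENNReal.ofReal_add (by positivity) (by positivity),
    ← ENNReal.ofReal_add (by positivity) (by positivity)]
  constructor
  · refine ENNReal.ofReal_le_ofReal ?_
    nlinarith [hcauchy a ((a : ℝ) - b), sq_nonneg ((a : ℝ) - b)]
  · refine ENNReal.ofReal_le_ofReal ?_
    nlinarith [hcauchy b ((a : ℝ) - b), sq_nonneg ((a : ℝ) - b)]

/-- The Riemann sums of `∫_0^h σ²` on the regular grid with `n + 1` pieces. -/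
def riemannSum (σ : ℝ≥0 → Ω → ℝ≥0) (h : ℝ≥0) (n : ℕ) (ω : Ω) : ℝ≥0 :=
  ∑ i ∈ Finset.range (n + 1), σ (grid 0 (mesh h n) i) ω ^ 2 * mesh h n

/-- The integrated squared volatility `∫_0^h σ²`. -/
def intVar (σ : ℝ≥0 → Ω → ℝ≥0) (h : ℝ≥0) (ω : Ω) : ℝ≥0∞ :=
  timeIntegral h (fun s => (σ s ω : ℝ≥0∞) ^ 2)

lemma measurable_intVar (hσ : Measurable fun p : ℝ × Ω => σ p.1.toNNReal p.2) (h : ℝ≥0) :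
    Measurable (intVar σ h) :=
  (hσ.coe_nnreal_ennreal.pow_const 2).lintegral_prod_left'

lemma lintegral_intVar [SFinite μ] (hst : IsStationary σ μ)
    (hσ : Measurable fun p : ℝ × Ω => σ p.1.toNNReal p.2) (h : ℝ≥0) :
    ∫⁻ ω, intVar σ h ω ∂μ = h * ∫⁻ ω, (σ 0 ω : ℝ≥0∞) ^ 2 ∂μ :=
  lintegral_timeIntegral_comp hst hσ (g := fun x => (x : ℝ≥0∞) ^ 2) (by fun_prop) h

lemma ae_intVar_lt_top [SFinite μ] (hst : IsStationary σ μ)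
    (hσ : Measurable fun p : ℝ × Ω => σ p.1.toNNReal p.2) (hB : AssumptionB σ μ) (h : ℝ≥0) :
    ∀ᵐ ω ∂μ, intVar σ h ω < ∞ := by
  refine ae_lt_top (measurable_intVar hσ h) ?_
  rw [lintegral_intVar hst hσ]
  exact ENNReal.mul_ne_top ENNReal.coe_ne_top (ne_of_lt hB)

lemma enorm_coe_sub_toReal_le {v : ℝ≥0} {V D : ℝ≥0∞} (hV : V < ∞) (h1 : (v : ℝ≥0∞) ≤ V + D)
    (h2 : V ≤ v + D) : ‖(v : ℝ) - V.toReal‖ₑ ≤ D := by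
  lift V to ℝ≥0 using hV.ne
  induction D with
  | top => exact le_top
  | coe D =>
    have h1' : (v : ℝ) ≤ V + D := by exact_mod_cast h1
    have h2' : (V : ℝ) ≤ v + D := by exact_mod_cast h2
    rw [ENNReal.coe_toReal, Real.enorm_eq_ofReal_abs, ← ENNReal.ofReal_coe_nnreal (p := D)]
    exact ENNReal.ofReal_le_ofReal (abs_le.2 ⟨by linarith, by linarith⟩)

/-- The difference is at most `(1 + ε⁻¹)` times the squared `L²` sampling error plus `ε ∫_0^h σ²`.
The first term vanishes in mean for fixed `ε` as the mesh shrinks; the second has mean `ε h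
E[σ_0²]`. -/
lemma tendsto_riemannSum [IsProbabilityMeasure μ] (hst : IsStationary σ μ)
    (hσ : Measurable fun p : ℝ × Ω => σ p.1.toNNReal p.2)
    (hA : AssumptionA σ μ) (hB : AssumptionB σ μ) {h : ℝ≥0} (hh : 0 < h) :
    Tendsto (fun n => ∫⁻ ω, ‖(riemannSum σ h n ω : ℝ) - (intVar σ h ω).toReal‖ₑ ∂μ)
      atTop (𝓝 0) := by
  set m := ∫⁻ ω, (σ 0 ω : ℝ≥0∞) ^ 2 ∂μ with hm
  refine tendsto_zero_of_eventually_le_mul (C := 1 + h * m) (by simp)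
    (ENNReal.add_ne_top.2 ⟨ENNReal.one_ne_top,
      ENNReal.mul_ne_top ENNReal.coe_ne_top (ne_of_lt hB)⟩) fun ε hε => ?_
  rcases eq_or_ne ε ∞ with rfl | hεt
  · rw [ENNReal.mul_top (by simp)]
    exact Eventually.of_forall fun _ => le_top
  lift ε to ℝ≥0 using hεt
  have hε' : 0 < ε := by exact_mod_cast hε
  have hlim := ENNReal.Tendsto.const_mul (a := 1 + ((ε⁻¹ : ℝ≥0) : ℝ≥0∞))
    (tendsto_succ_mul_meanOscillation hst hσ hA hB hh)
    (Or.inr (ENNReal.add_ne_top.2 ⟨ENNReal.one_ne_top, ENNReal.coe_ne_top⟩))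
  rw [mul_zero] at hlim
  filter_upwards [ENNReal.tendsto_nhds_zero.1 hlim ε hε] with n hn
  set τ := grid 0 (mesh h n) with hτdef
  have hτ : Monotone τ := grid_mono _ _
  set K : Ω → ℝ → ℝ := fun ω s => stepFun τ (n + 1) (fun i => σ (τ i) ω) s with hK
  have hgrid : ∀ f : ℝ → ℝ≥0∞, ∫⁻ s in Set.Ioc (0 : ℝ) h, f s
      = ∑ i ∈ Finset.range (n + 1), ∫⁻ s in Set.Ioc (τ i : ℝ) (τ (i + 1)), f s := by
    intro f
    rw [← lintegral_Ioc_eq_sum hτ, hτdef, grid_zero, grid_mesh, zero_add, NNReal.coe_zero]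
  set D : Ω → ℝ≥0∞ := fun ω => (1 + ((ε⁻¹ : ℝ≥0) : ℝ≥0∞)) *
      (∫⁻ s in Set.Ioc (0 : ℝ) h, ‖K ω s - σ s.toNNReal ω‖ₑ ^ 2) + ε * intVar σ h ω with hD
  have hKm : ∀ ω, Measurable (K ω) := fun ω =>
    Finset.measurable_sum _ fun i _ => measurable_const.indicator measurableSet_Ioc
  have hDeq : ∀ ω, D ω = ∫⁻ s in Set.Ioc (0 : ℝ) h,
      ((1 + ((ε⁻¹ : ℝ≥0) : ℝ≥0∞)) * ‖K ω s - σ s.toNNReal ω‖ₑ ^ 2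
        + ε * (σ s.toNNReal ω : ℝ≥0∞) ^ 2) := by
    intro ω
    have hσω : Measurable fun s : ℝ => σ s.toNNReal ω := hσ.comp measurable_prodMk_right
    have hm1 : Measurable fun s : ℝ => ‖K ω s - σ s.toNNReal ω‖ₑ ^ 2 :=
      (((hKm ω).sub hσω.coe_nnreal_real).enorm.pow_const 2)
    rw [lintegral_add_left (hm1.const_mul _), lintegral_const_mul _ hm1,
      lintegral_const_mul _ (hσω.coe_nnreal_ennreal.pow_const 2)]
    rfl
  have hR : ∀ ω, (riemannSum σ h n ω : ℝ≥0∞)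
      = ∑ i ∈ Finset.range (n + 1), ∫⁻ s in Set.Ioc (τ i : ℝ) (τ (i + 1)),
        (σ (τ i) ω : ℝ≥0∞) ^ 2 := by
    intro ω
    unfold riemannSum
    push_cast
    refine Finset.sum_congr rfl fun i _ => ?_
    rw [lintegral_const, Measure.restrict_apply_univ, Real.volume_Ioc, hτdef, grid_succ]
    simp
  have hVR : ∀ ω, intVar σ h ω < ∞ →
      ‖(riemannSum σ h n ω : ℝ) - (intVar σ h ω).toReal‖ₑ ≤ D ω := by
    intro ω hω
    have hσω : Measurable fun s : ℝ => (σ s.toNNReal ω : ℝ≥0∞) ^ 2 :=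
      (hσ.comp measurable_prodMk_right).coe_nnreal_ennreal.pow_const 2
    refine enorm_coe_sub_toReal_le hω ?_ ?_
    · rw [hR, hDeq]
      unfold intVar timeIntegral
      rw [← lintegral_add_left hσω, hgrid]
      refine Finset.sum_le_sum fun i hi => setLIntegral_mono' measurableSet_Ioc fun s hs => ?_
      simp only [hK]
      rw [stepFun_of_mem hτ (Finset.mem_range.1 hi) _ hs]
      exact (coe_sq_le_add _ _ ε hε').2
    · rw [hR, hDeq, hgrid, ← Finset.sum_add_distrib]
      unfold intVar timeIntegral
      rw [hgrid]
      refine Finset.sum_le_sum fun i hi => ?_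
      rw [← lintegral_add_left measurable_const]
      refine setLIntegral_mono' measurableSet_Ioc fun s hs => ?_
      simp only [hK]
      rw [stepFun_of_mem hτ (Finset.mem_range.1 hi) _ hs, enorm_sub_rev]
      exact (coe_sq_le_add _ _ ε hε').1
  have hosc := lintegral_stepFun_sub_sq hst hσ 0 h n
  simp only [NNReal.coe_zero, zero_add] at hosc
  calc ∫⁻ ω, ‖(riemannSum σ h n ω : ℝ) - (intVar σ h ω).toReal‖ₑ ∂μ
      ≤ ∫⁻ ω, D ω ∂μ := lintegral_mono_ae
        ((ae_intVar_lt_top hst hσ hB h).mono fun ω hω => hVR ω hω)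
    _ = (1 + ((ε⁻¹ : ℝ≥0) : ℝ≥0∞)) * (((n : ℝ≥0∞) + 1) * meanOscillation σ μ (mesh h n))
        + ε * (h * m) := by
      rw [hD, lintegral_add_right _ ((measurable_intVar hσ h).const_mul _),
        lintegral_const_mul _ (measurable_intVar hσ h), lintegral_intVar hst hσ,
        lintegral_const_mul' _ _
          (ENNReal.add_ne_top.2 ⟨ENNReal.one_ne_top, ENNReal.coe_ne_top⟩), ← hosc]
    _ ≤ ε + ε * (h * m) := by gcongr
    _ = (1 + h * m) * ε := by ring

end Approximation

/-- Jensen's inequality for powers and `[0, ∞]`-valued functions. -/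
lemma lintegral_rpow_le_lintegral_rpow {α : Type*} {mα : MeasurableSpace α} {ν : Measure α}
    [IsProbabilityMeasure ν] {f : α → ℝ≥0∞} (hf : AEMeasurable f ν) {r : ℝ} (hr : 1 ≤ r) :
    (∫⁻ x, f x ∂ν) ^ r ≤ ∫⁻ x, f x ^ r ∂ν := by
  have h := eLpNorm'_le_eLpNorm'_of_exponent_le (p := 1) (q := r) one_pos hr ν
    hf.aestronglyMeasurable
  simp only [eLpNorm', enorm_eq_self, ENNReal.rpow_one, div_one] at h
  have hr0 : 0 < r := by linarith
  calc (∫⁻ x, f x ∂ν) ^ r ≤ ((∫⁻ x, f x ^ r ∂ν) ^ (1 / r)) ^ r := by gcongr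
    _ = ∫⁻ x, f x ^ r ∂ν := by
      rw [← ENNReal.rpow_mul, one_div_mul_cancel hr0.ne', ENNReal.rpow_one]

lemma lintegral_add_add {α : Type*} {mα : MeasurableSpace α} {ν : Measure α} {f g : α → ℝ≥0∞}
    (hf : AEMeasurable f ν) (hg : AEMeasurable g ν) (k : α → ℝ≥0∞) :
    ∫⁻ x, (f x + g x + k x) ∂ν = ∫⁻ x, f x ∂ν + ∫⁻ x, g x ∂ν + ∫⁻ x, k x ∂ν := by
  have hfg : AEMeasurable (fun x => f x + g x) ν := hf.add hg
  rw [lintegral_add_left' hfg, lintegral_add_left' hf]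

lemma tendsto_lintegral_enorm_of_sq {μ : Measure Ω} [IsProbabilityMeasure μ] {Z : ℕ → Ω → ℝ}
    (hZ : ∀ n, AEMeasurable (Z n) μ)
    (h : Tendsto (fun n => ∫⁻ ω, ‖Z n ω‖ₑ ^ 2 ∂μ) atTop (𝓝 0)) :
    Tendsto (fun n => ∫⁻ ω, ‖Z n ω‖ₑ ∂μ) atTop (𝓝 0) := by
  have h2 : Tendsto (fun n => (∫⁻ ω, ‖Z n ω‖ₑ ∂μ) ^ (2 : ℝ)) atTop (𝓝 0) := by
    refine tendsto_of_tendsto_of_tendsto_of_le_of_le tendsto_const_nhds h (fun _ => zero_le)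
      fun n => ?_
    simpa using lintegral_rpow_le_lintegral_rpow (hZ n).enorm (r := 2) one_le_two
  have h3 := h2.ennrpow_const (1 / 2)
  simp only [← ENNReal.rpow_mul] at h3
  norm_num at h3
  exact h3

/-! ### Simple integrands and step functions as elementary integrands -/

section Elementary

variable {μ : Measure Ω} {W : ℝ≥0 → Ω → ℝ} {F : Filtration ℝ≥0 mΩ}

lemma SimpleIntegrand.mem_elementary [IsProbabilityMeasure μ] (H : SimpleIntegrand F) (T : ℝ≥0) :
    ((fun s ω => (Set.Ioc (0 : ℝ) T).indicator (fun s => H.eval s.toNNReal ω) s,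
      H.integral W T) : (ℝ → Ω → ℝ) × (Ω → ℝ)) ∈ elementary F W μ := by
  classical
  -- When `T < H.time i` the truncated interval degenerates to the point `T`, where `H.ξ i` need not
  -- be `F T`-measurable; replacing it by zero restores adaptedness without changing either
  -- component.
  set ξ : ℕ → Ω → ℝ := fun i ω => if H.time i ≤ T then H.ξ i ω else 0 with hξ
  have hsum : ((fun s ω => (Set.Ioc (0 : ℝ) T).indicator (fun s => H.eval s.toNNReal ω) s,
      H.integral W T) : (ℝ → Ω → ℝ) × (Ω → ℝ))
      = ∑ i ∈ Finset.range H.n,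
        ((fun s ω => (Set.Ioc ((min (H.time i) T : ℝ≥0) : ℝ) (min (H.time (i + 1)) T : ℝ≥0)).indicator
            (fun _ => ξ i ω) s,
          fun ω => ξ i ω * (W (min (H.time (i + 1)) T) ω - W (min (H.time i) T) ω)) :
          (ℝ → Ω → ℝ) × (Ω → ℝ)) := by
    refine Prod.ext ?_ ?_
    · funext s ω
      simp only [Prod.fst_sum, Finset.sum_apply]
      by_cases hs : s ∈ Set.Ioc (0 : ℝ) T
      · rw [Set.indicator_of_mem hs]
        unfold SimpleIntegrand.eval
        refine Finset.sum_congr rfl fun i _ => ?_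
        have hs' : ((s.toNNReal : ℝ≥0) : ℝ) = s := Real.coe_toNNReal s hs.1.le
        have hmem : s.toNNReal ∈ Set.Ioc (H.time i) (H.time (i + 1)) ↔
            s ∈ Set.Ioc ((min (H.time i) T : ℝ≥0) : ℝ) (min (H.time (i + 1)) T : ℝ≥0) := by
          rw [Set.mem_Ioc, Set.mem_Ioc, ← NNReal.coe_lt_coe, ← NNReal.coe_le_coe, hs',
            NNReal.coe_min, NNReal.coe_min, min_lt_iff, le_min_iff]
          constructor
          · exact fun h => ⟨Or.inl h.1, h.2, hs.2⟩
          · exact fun h => ⟨h.1.resolve_right (not_lt.2 hs.2), h.2.1⟩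
        by_cases hm : s.toNNReal ∈ Set.Ioc (H.time i) (H.time (i + 1))
        · rw [Set.indicator_of_mem hm, Set.indicator_of_mem (hmem.1 hm)]
          have : H.time i ≤ T := by
            rw [← NNReal.coe_le_coe]
            have := NNReal.coe_lt_coe.2 hm.1
            rw [hs'] at this
            exact this.le.trans hs.2
          simp [hξ, this]
        · rw [Set.indicator_of_notMem hm, Set.indicator_of_notMem (fun h => hm (hmem.2 h))]
      · rw [Set.indicator_of_notMem hs]
        refine (Finset.sum_eq_zero fun i _ => Set.indicator_of_notMem (fun h => hs ?_) _).symm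
        exact ⟨(NNReal.coe_nonneg _).trans_lt h.1,
          h.2.trans (NNReal.coe_le_coe.2 (min_le_right _ _))⟩
    · funext ω
      simp only [Prod.snd_sum, Finset.sum_apply]
      unfold SimpleIntegrand.integral
      refine Finset.sum_congr rfl fun i _ => ?_
      by_cases h : H.time i ≤ T
      · simp [hξ, h]
      · have h1 : T ≤ H.time i := le_of_not_ge h
        have h2 : T ≤ H.time (i + 1) := h1.trans (H.mono i.le_succ)
        simp [min_eq_right h1, min_eq_right h2]
  rw [hsum]
  refine Submodule.sum_mem _ fun i _ => Submodule.subset_span ?_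
  have hξm : Measurable[F (min (H.time i) T)] (ξ i) := by
    by_cases h : H.time i ≤ T
    · rw [min_eq_left h]
      simpa [hξ, h] using H.meas i
    · simp [hξ, h]
  obtain ⟨C, hC⟩ := H.bdd i
  refine ⟨_, _, ξ i, min_le_min_right T (H.mono i.le_succ), hξm, ?_, rfl⟩
  refine MemLp.of_bound (hξm.mono (F.le _) le_rfl).aestronglyMeasurable |C| (ae_of_all _ fun ω => ?_)
  by_cases h : H.time i ≤ T
  · simpa [hξ, h] using (hC ω).trans (le_abs_self C)
  · simp [hξ, h]

lemma SimpleIntegrand.measurable_eval (H : SimpleIntegrand F) :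
    Measurable fun p : ℝ × Ω => H.eval p.1.toNNReal p.2 := by
  unfold SimpleIntegrand.eval
  refine Finset.measurable_sum _ fun i _ => ?_
  have hset : MeasurableSet {p : ℝ × Ω | p.1.toNNReal ∈ Set.Ioc (H.time i) (H.time (i + 1))} :=
    (measurable_real_toNNReal.comp measurable_fst) measurableSet_Ioc
  have hξ : Measurable fun p : ℝ × Ω => H.ξ i p.2 :=
    ((H.meas i).mono (F.le _) le_rfl).comp measurable_snd
  exact hξ.indicator hset

lemma SimpleIntegrand.aemeasurable_integral (H : SimpleIntegrand F) (hW : IsBrownianWrt F W μ)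
    (T : ℝ≥0) : AEMeasurable (H.integral W T) μ := by
  have h : Measurable (H.integral W T) := by
    unfold SimpleIntegrand.integral
    refine Finset.measurable_sum _ fun i _ => ((H.meas i).mono (F.le _) le_rfl).mul ?_
    exact ((hW.adapted _).mono (F.le _) le_rfl).sub ((hW.adapted _).mono (F.le _) le_rfl)
  exact h.aemeasurable

lemma stepFun_mem_elementary {τ : ℕ → ℝ≥0} (hτ : Monotone τ) (n : ℕ) {x : ℕ → Ω → ℝ}
    (hx : ∀ i, Measurable[F (τ i)] (x i)) (hx2 : ∀ i, MemLp (x i) 2 μ) :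
    ((fun s ω => stepFun τ n (fun i => x i ω) s,
      fun ω => ∑ i ∈ Finset.range n, x i ω * (W (τ (i + 1)) ω - W (τ i) ω)) :
        (ℝ → Ω → ℝ) × (Ω → ℝ)) ∈ elementary F W μ := by
  have hsum : ((fun s ω => stepFun τ n (fun i => x i ω) s,
      fun ω => ∑ i ∈ Finset.range n, x i ω * (W (τ (i + 1)) ω - W (τ i) ω)) :
        (ℝ → Ω → ℝ) × (Ω → ℝ))
      = ∑ i ∈ Finset.range n,
        ((fun s ω => (Set.Ioc (τ i : ℝ) (τ (i + 1))).indicator (fun _ => x i ω) s,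
          fun ω => x i ω * (W (τ (i + 1)) ω - W (τ i) ω)) : (ℝ → Ω → ℝ) × (Ω → ℝ)) := by
    refine Prod.ext ?_ ?_
    · funext s ω
      simp only [Prod.fst_sum, Finset.sum_apply]
      rfl
    · funext ω
      simp only [Prod.snd_sum, Finset.sum_apply]
  rw [hsum]
  exact Submodule.sum_mem _ fun i _ =>
    Submodule.subset_span ⟨_, _, x i, hτ i.le_succ, hx i, hx2 i, rfl⟩

end Elementary

/-! ### Increments of the log-price as limits of sampled integrals -/

section Model

variable {μ : Measure Ω} {F : Filtration ℝ≥0 mΩ} {σ : ℝ≥0 → Ω → ℝ≥0} {W X : ℝ≥0 → Ω → ℝ}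

namespace IsStochVolModel

lemma measurable_vol (hmodel : IsStochVolModel F σ W X μ) :
    Measurable fun p : ℝ × Ω => σ p.1.toNNReal p.2 :=
  measurable_uncurry_of_progressive hmodel.ito.progressive

lemma memLp_vol (hmodel : IsStochVolModel F σ W X μ) (hB : AssumptionB σ μ) (s : ℝ≥0) :
    MemLp (fun ω => (σ s ω : ℝ)) 2 μ := by
  have hm := (measurable_of_uncurry hmodel.measurable_vol s).coe_nnreal_real
  refine ⟨hm.aestronglyMeasurable, ?_⟩
  rw [eLpNorm_lt_top_iff_lintegral_rpow_enorm_lt_top (by norm_num) (by norm_num)]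
  unfold AssumptionB at hB
  have := hmodel.stationary.lintegral_comp_eq (g := fun x => (x : ℝ≥0∞) ^ 2) (by fun_prop) s
  simpa [this, Real.enorm_eq_ofReal_abs] using hB

/-- The elementary integral of the volatility sampled on a regular grid of `(t, t + h]`. -/
def sampledIntegral (σ : ℝ≥0 → Ω → ℝ≥0) (W : ℝ≥0 → Ω → ℝ) (t h : ℝ≥0) (n : ℕ) (ω : Ω) : ℝ :=
  ∑ i ∈ Finset.range (n + 1), (σ (grid t (mesh h n) i) ω : ℝ) *
    (W (grid t (mesh h n) (i + 1)) ω - W (grid t (mesh h n) i) ω)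

lemma enorm_sub_sq_le_two (a b c : ℝ) : ‖a - b‖ₑ ^ 2 ≤ 2 * ‖a - c‖ₑ ^ 2 + 2 * ‖b - c‖ₑ ^ 2 := by
  have h2 : (2 : ℝ≥0∞) = ENNReal.ofReal 2 := by simp
  rw [enorm_sq_eq_ofReal, enorm_sq_eq_ofReal, enorm_sq_eq_ofReal, h2,
    ← ENNReal.ofReal_mul (by norm_num), ← ENNReal.ofReal_mul (by norm_num),
    ← ENNReal.ofReal_add (by positivity) (by positivity)]
  refine ENNReal.ofReal_le_ofReal ?_
  nlinarith [sq_nonneg (a - c + (b - c))]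

/-- The isometry turns the claim into an `L²` estimate between integrands: `H n - H' n` is close to
`σ - σ = 0` on `(0, t]` and to `σ` on `(t, t + h]`, exactly where the sampled step function lives.
-/
lemma tendsto_integral_sub_sampledIntegral [IsProbabilityMeasure μ]
    (hmodel : IsStochVolModel F σ W X μ) (hA : AssumptionA σ μ) (hB : AssumptionB σ μ)
    (t : ℝ≥0) {h : ℝ≥0} (hh : 0 < h) {H H' : ℕ → SimpleIntegrand F}
    (hH : Tendsto (fun n => ∫⁻ ω, timeIntegral (t + h)
      (fun s => ‖(H n).eval s ω - σ s ω‖ₑ ^ 2) ∂μ) atTop (𝓝 0))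
    (hH' : Tendsto (fun n => ∫⁻ ω, timeIntegral t
      (fun s => ‖(H' n).eval s ω - σ s ω‖ₑ ^ 2) ∂μ) atTop (𝓝 0)) :
    Tendsto (fun n => ∫⁻ ω, ‖(H n).integral W (t + h) ω - (H' n).integral W t ω
      - sampledIntegral σ W t h n ω‖ₑ ^ 2 ∂μ) atTop (𝓝 0) := by
  have hσ := hmodel.measurable_vol
  have hK := tendsto_succ_mul_meanOscillation hmodel.stationary hσ hA hB hh
  have hlim := ((ENNReal.Tendsto.const_mul (a := 2) hH (by simp)).add
    (ENNReal.Tendsto.const_mul (a := 2) hH' (by simp))).add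
    (ENNReal.Tendsto.const_mul (a := 2) hK (by simp))
  simp only [mul_zero, add_zero] at hlim
  refine tendsto_of_tendsto_of_tendsto_of_le_of_le tendsto_const_nhds hlim (fun _ => zero_le)
    fun n => ?_
  simp only
  set τ := grid t (mesh h n) with hτdef
  have hτ : Monotone τ := grid_mono _ _
  have hmemK : ((fun s ω => stepFun τ (n + 1) (fun i => (σ (τ i) ω : ℝ)) s,
      sampledIntegral σ W t h n) : (ℝ → Ω → ℝ) × (Ω → ℝ)) ∈ elementary F W μ :=
    stepFun_mem_elementary hτ (n + 1)
      (fun i => (hmodel.ito.progressive.stronglyAdapted (τ i)).measurable)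
      (fun i => hmodel.memLp_vol hB (τ i))
  have hmem := Submodule.sub_mem _ (Submodule.sub_mem _
    ((H n).mem_elementary (W := W) (μ := μ) (t + h)) ((H' n).mem_elementary (W := W) t)) hmemK
  have hiso := elementary_isometry hmodel.brownian hmem
  simp only [Prod.fst_sub, Prod.snd_sub, Pi.sub_apply] at hiso
  rw [hiso, ← lintegral_stepFun_sub_sq hmodel.stationary hσ t h n]
  set A : ℝ × Ω → ℝ≥0∞ := fun p => ‖(H n).eval p.1.toNNReal p.2 - σ p.1.toNNReal p.2‖ₑ ^ 2
  set B : ℝ × Ω → ℝ≥0∞ := fun p => ‖(H' n).eval p.1.toNNReal p.2 - σ p.1.toNNReal p.2‖ₑ ^ 2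
  set C : ℝ × Ω → ℝ≥0∞ := fun p =>
    ‖stepFun τ (n + 1) (fun i => σ (τ i) p.2) p.1 - σ p.1.toNNReal p.2‖ₑ ^ 2
  have hAm : Measurable A :=
    ((H n).measurable_eval.sub hσ.coe_nnreal_real).enorm.pow_const 2
  have hBm : Measurable B :=
    ((H' n).measurable_eval.sub hσ.coe_nnreal_real).enorm.pow_const 2
  have hpt : ∀ (ω : Ω) (s : ℝ),
      ‖(Set.Ioc (0 : ℝ) (t + h : ℝ≥0)).indicator (fun s => (H n).eval s.toNNReal ω) s
        - (Set.Ioc (0 : ℝ) t).indicator (fun s => (H' n).eval s.toNNReal ω) s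
        - stepFun τ (n + 1) (fun i => σ (τ i) ω) s‖ₑ ^ 2
      ≤ (Set.Ioc (0 : ℝ) (t + h : ℝ≥0)).indicator (fun s => 2 * A (s, ω)) s
        + (Set.Ioc (0 : ℝ) t).indicator (fun s => 2 * B (s, ω)) s
        + (Set.Ioc (t : ℝ) (t + h : ℝ≥0)).indicator (fun s => 2 * C (s, ω)) s := by
    intro ω s
    have hτ0 : τ 0 = t := grid_zero _ _
    have hτn : τ (n + 1) = t + h := grid_mesh _ _ _
    have htT : (t : ℝ) ≤ (t + h : ℝ≥0) := NNReal.coe_le_coe.2 le_self_add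
    by_cases h1 : s ∈ Set.Ioc (0 : ℝ) (t + h : ℝ≥0)
    · by_cases h2 : s ∈ Set.Ioc (0 : ℝ) t
      · have h3 : s ∉ Set.Ioc (t : ℝ) (t + h : ℝ≥0) := fun h => absurd h.1 (not_lt.2 h2.2)
        rw [Set.indicator_of_mem h1, Set.indicator_of_mem h2, Set.indicator_of_mem h1,
          Set.indicator_of_mem h2, Set.indicator_of_notMem h3,
          stepFun_of_notMem hτ _ (by rwa [hτ0, hτn]), sub_zero, add_zero]
        exact enorm_sub_sq_le_two _ _ _
      · have h3 : s ∈ Set.Ioc (t : ℝ) (t + h : ℝ≥0) :=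
          ⟨not_le.1 fun h => h2 ⟨h1.1, h⟩, h1.2⟩
        rw [Set.indicator_of_mem h1, Set.indicator_of_notMem h2, Set.indicator_of_mem h1,
          Set.indicator_of_notMem h2, Set.indicator_of_mem h3, sub_zero, add_zero]
        exact enorm_sub_sq_le_two _ _ _
    · have h2 : s ∉ Set.Ioc (0 : ℝ) t := fun h => h1 ⟨h.1, h.2.trans htT⟩
      have h3 : s ∉ Set.Ioc (t : ℝ) (t + h : ℝ≥0) := fun h =>
        h1 ⟨(NNReal.coe_nonneg t).trans_lt h.1, h.2⟩
      rw [Set.indicator_of_notMem h1, Set.indicator_of_notMem h2,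
        stepFun_of_notMem hτ _ (by rwa [hτ0, hτn])]
      simp
  have hAω : ∀ ω, Measurable fun s => A (s, ω) := fun ω => hAm.comp measurable_prodMk_right
  have hBω : ∀ ω, Measurable fun s => B (s, ω) := fun ω => hBm.comp measurable_prodMk_right
  have hAi : Measurable fun ω => ∫⁻ s in Set.Ioc (0 : ℝ) (t + h : ℝ≥0), A (s, ω) :=
    hAm.lintegral_prod_left'
  have hBi : Measurable fun ω => ∫⁻ s in Set.Ioc (0 : ℝ) t, B (s, ω) :=
    hBm.lintegral_prod_left'
  refine (lintegral_mono fun ω => lintegral_mono fun s => hpt ω s).trans (le_of_eq ?_)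
  have hinner : ∀ ω, ∫⁻ s, ((Set.Ioc (0 : ℝ) (t + h : ℝ≥0)).indicator (fun s => 2 * A (s, ω)) s
        + (Set.Ioc (0 : ℝ) t).indicator (fun s => 2 * B (s, ω)) s
        + (Set.Ioc (t : ℝ) (t + h : ℝ≥0)).indicator (fun s => 2 * C (s, ω)) s)
      = 2 * (∫⁻ s in Set.Ioc (0 : ℝ) (t + h : ℝ≥0), A (s, ω))
        + 2 * (∫⁻ s in Set.Ioc (0 : ℝ) t, B (s, ω))
        + 2 * (∫⁻ s in Set.Ioc (t : ℝ) (t + h : ℝ≥0), C (s, ω)) := by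
    intro ω
    have m1 := ((hAω ω).const_mul 2).indicator (measurableSet_Ioc (a := (0 : ℝ))
      (b := (t + h : ℝ≥0)))
    have m2 := ((hBω ω).const_mul 2).indicator (measurableSet_Ioc (a := (0 : ℝ)) (b := (t : ℝ)))
    rw [lintegral_add_add m1.aemeasurable m2.aemeasurable,
      lintegral_indicator measurableSet_Ioc, lintegral_indicator measurableSet_Ioc,
      lintegral_indicator measurableSet_Ioc, lintegral_const_mul' _ _ (by norm_num),
      lintegral_const_mul' _ _ (by norm_num), lintegral_const_mul' _ _ (by norm_num)]
  simp_rw [hinner]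
  rw [lintegral_add_add (hAi.const_mul 2).aemeasurable (hBi.const_mul 2).aemeasurable,
    lintegral_const_mul' _ _ (by norm_num), lintegral_const_mul' _ _ (by norm_num),
    lintegral_const_mul' _ _ (by norm_num)]
  rfl

lemma aemeasurable_sampledIntegral (hmodel : IsStochVolModel F σ W X μ) (t h : ℝ≥0) (n : ℕ) :
    AEMeasurable (sampledIntegral σ W t h n) μ := by
  have hm : ∀ s, Measurable (W s) := fun s => (hmodel.brownian.adapted s).mono (F.le _) le_rfl
  have hv : ∀ s, Measurable fun ω => (σ s ω : ℝ) := fun s =>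
    (measurable_of_uncurry hmodel.measurable_vol s).coe_nnreal_real
  exact Measurable.aemeasurable
    (Finset.measurable_sum _ fun i _ => (hv _).mul ((hm _).sub (hm _)))

/-- The increment `X (t + h) - X t` is the `L²`-limit of the elementary integrals of the sampled
volatility. -/
lemma tendsto_sampledIntegral [IsProbabilityMeasure μ]
    (hmodel : IsStochVolModel F σ W X μ) (hA : AssumptionA σ μ) (hB : AssumptionB σ μ)
    (t : ℝ≥0) {h : ℝ≥0} (hh : 0 < h) :
    Tendsto (fun n => ∫⁻ ω, ‖sampledIntegral σ W t h n ω - (X (t + h) ω - X t ω)‖ₑ ^ 2 ∂μ)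
      atTop (𝓝 0) := by
  -- The approximating integrands for the horizons `t + h` and `t` are unrelated, so both sequences
  -- have to be carried along.
  obtain ⟨H, hH, hHX⟩ := hmodel.ito.limit (t + h)
  obtain ⟨H', hH', hHX'⟩ := hmodel.ito.limit t
  have hS := hmodel.tendsto_integral_sub_sampledIntegral hA hB t hh hH hH'
  have hlim := ((ENNReal.Tendsto.const_mul (a := 3) hHX (by simp)).add
    (ENNReal.Tendsto.const_mul (a := 3) hHX' (by simp))).add
    (ENNReal.Tendsto.const_mul (a := 3) hS (by simp))
  simp only [mul_zero, add_zero] at hlim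
  refine tendsto_of_tendsto_of_tendsto_of_le_of_le tendsto_const_nhds hlim (fun _ => zero_le)
    fun n => ?_
  simp only
  have hX := hmodel.ito.aemeasurable
  have m1 : AEMeasurable (fun ω =>
      3 * ‖X (t + h) ω - X 0 ω - (H n).integral W (t + h) ω‖ₑ ^ 2) μ :=
    ((((hX _).sub (hX _)).sub ((H n).aemeasurable_integral hmodel.brownian _)).enorm.pow_const
      2).const_mul 3
  have m2 : AEMeasurable (fun ω =>
      3 * ‖X t ω - X 0 ω - (H' n).integral W t ω‖ₑ ^ 2) μ :=
    ((((hX _).sub (hX _)).sub ((H' n).aemeasurable_integral hmodel.brownian _)).enorm.pow_const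
      2).const_mul 3
  rw [← lintegral_const_mul' _ _ (by norm_num), ← lintegral_const_mul' _ _ (by norm_num),
    ← lintegral_const_mul' _ _ (by norm_num), ← lintegral_add_add m1 m2]
  refine lintegral_mono fun ω => ?_
  have h3 : (3 : ℝ≥0∞) = ENNReal.ofReal 3 := by simp
  rw [enorm_sq_eq_ofReal, enorm_sq_eq_ofReal, enorm_sq_eq_ofReal, enorm_sq_eq_ofReal, h3,
    ← ENNReal.ofReal_mul (by norm_num), ← ENNReal.ofReal_mul (by norm_num),
    ← ENNReal.ofReal_mul (by norm_num), ← ENNReal.ofReal_add (by positivity) (by positivity),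
    ← ENNReal.ofReal_add (by positivity) (by positivity)]
  refine ENNReal.ofReal_le_ofReal ?_
  set a := X (t + h) ω - X 0 ω - (H n).integral W (t + h) ω
  set b := X t ω - X 0 ω - (H' n).integral W t ω
  set c := (H n).integral W (t + h) ω - (H' n).integral W t ω - sampledIntegral σ W t h n ω
  have e : sampledIntegral σ W t h n ω - (X (t + h) ω - X t ω) = -(a - b + c) := by
    simp only [a, b, c]; ring
  rw [e]
  nlinarith [sq_nonneg (a + b), sq_nonneg (a - c), sq_nonneg (b + c)]

end IsStochVolModel

end Model

/-! ### The law and the moments of an increment -/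

section Law

variable {μ : Measure Ω} {F : Filtration ℝ≥0 mΩ} {σ : ℝ≥0 → Ω → ℝ≥0} {W X : ℝ≥0 → Ω → ℝ}

lemma abs_exp_neg_sub_exp_neg_le {x y : ℝ} (hx : 0 ≤ x) (hy : 0 ≤ y) :
    |Real.exp (-x) - Real.exp (-y)| ≤ |x - y| := by
  wlog hxy : x ≤ y generalizing x y
  · rw [abs_sub_comm, abs_sub_comm x]
    exact this hy hx (le_of_not_ge hxy)
  have h1 : Real.exp (-y) = Real.exp (-x) * Real.exp (x - y) := by
    rw [← Real.exp_add]; ring_nf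
  have h2 : x - y + 1 ≤ Real.exp (x - y) := Real.add_one_le_exp _
  have h3 : Real.exp (x - y) ≤ 1 := Real.exp_le_one_iff.2 (by linarith)
  have h4 : Real.exp (-x) ≤ 1 := Real.exp_le_one_iff.2 (by linarith)
  have h5 : 0 < Real.exp (-x) := Real.exp_pos _
  rw [abs_of_nonneg (by rw [h1]; nlinarith), abs_sub_comm, abs_of_nonneg (by linarith), h1]
  nlinarith

lemma enorm_cexp_mul_I_sub_le (u x y : ℝ) :
    ‖Complex.exp (u * x * Complex.I) - Complex.exp (u * y * Complex.I)‖ₑ ≤ ‖u‖ₑ * ‖x - y‖ₑ := by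
  have h : Complex.exp (u * x * Complex.I) - Complex.exp (u * y * Complex.I)
      = Complex.exp ((u * y : ℝ) * Complex.I)
        * (Complex.exp (Complex.I * (u * (x - y) : ℝ)) - 1) := by
    rw [mul_sub, ← Complex.exp_add, mul_one]
    congr 2 <;> push_cast <;> ring
  have h1 : ‖Complex.exp ((u * y : ℝ) * Complex.I)‖ₑ = 1 := by
    rw [← ofReal_norm, Complex.norm_exp_ofReal_mul_I, ENNReal.ofReal_one]
  rw [h, enorm_mul, h1, one_mul, ← enorm_mul]
  exact Real.enorm_exp_I_mul_ofReal_sub_one_le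

lemma tendsto_integral_of_enorm_sub_le [IsProbabilityMeasure μ] {g : ℕ → Ω → ℂ} {g' : Ω → ℂ}
    {Z : ℕ → Ω → ℝ≥0∞} {C : ℝ≥0∞} (hC : C ≠ ∞) (hg : ∀ n, AEStronglyMeasurable (g n) μ)
    (hg1 : ∀ n ω, ‖g n ω‖ ≤ 1) (hg' : AEStronglyMeasurable g' μ)
    (hle : ∀ n ω, ‖g n ω - g' ω‖ₑ ≤ C * Z n ω)
    (hZ : Tendsto (fun n => ∫⁻ ω, Z n ω ∂μ) atTop (𝓝 0)) :
    Tendsto (fun n => ∫ ω, g n ω ∂μ) atTop (𝓝 (∫ ω, g' ω ∂μ)) := by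
  refine tendsto_integral_of_L1 g' hg'
    (Eventually.of_forall fun n => Integrable.of_bound (hg n) 1 (ae_of_all _ (hg1 n))) ?_
  have h := ENNReal.Tendsto.const_mul hZ (Or.inr hC)
  rw [mul_zero] at h
  refine tendsto_of_tendsto_of_tendsto_of_le_of_le tendsto_const_nhds h (fun _ => zero_le)
    fun n => ?_
  simp only
  rw [← lintegral_const_mul' _ _ hC]
  exact lintegral_mono (hle n)

namespace IsStochVolModel

/-- Conditioning on the volatility gives the Gaussian characteristic function with variance the
Riemann sum over `(t, t + h]`; stationarity of the whole path then moves the grid to start at `0`.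
-/
lemma integral_exp_sampledIntegral [IsProbabilityMeasure μ] (hmodel : IsStochVolModel F σ W X μ)
    (t h : ℝ≥0) (n : ℕ) (u : ℝ) :
    ∫ ω, Complex.exp (u * (sampledIntegral σ W t h n ω : ℝ) * Complex.I) ∂μ
      = ∫ ω, Complex.exp (-(u ^ 2 / 2 * riemannSum σ h n ω : ℝ)) ∂μ := by
  have hv : ∀ s, Measurable fun ω => (σ s ω : ℝ) := fun s =>
    (measurable_of_uncurry hmodel.measurable_vol s).coe_nnreal_real
  have hind : IndepFun (fun ω (i : Fin (n + 1)) => (σ (grid t (mesh h n) i) ω : ℝ))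
      (fun ω s => W s ω) μ :=
    hmodel.indep.comp (φ := fun (y : ℝ≥0 → ℝ≥0) (i : Fin (n + 1)) => (y (grid t (mesh h n) i) : ℝ))
      (ψ := id) (by fun_prop) measurable_id
  have h1 := integral_exp_sum_mul_increments hmodel.brownian.brownian.toIsPreBrownianReal
    (grid_mono t (mesh h n)) (fun i : Fin (n + 1) => hv (grid t (mesh h n) i)) hind u
  have hd : ∀ i, ((grid t (mesh h n) (i + 1) : ℝ≥0) : ℝ) - grid t (mesh h n) i = mesh h n := by
    intro i
    rw [grid_succ, NNReal.coe_add]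
    ring
  simp only [hd] at h1
  unfold sampledIntegral
  simp only [Finset.sum_range]
  refine h1.trans ?_
  have h2 := ((hmodel.stationary t).comp (u := fun y : ℝ≥0 → ℝ≥0 =>
    Complex.exp (-(u ^ 2 / 2 * ∑ i : Fin (n + 1),
      (y (grid 0 (mesh h n) i) : ℝ) ^ 2 * mesh h n : ℝ))) (by fun_prop)).integral_eq
  simp only [Function.comp_apply] at h2
  have hg : ∀ i : ℕ, t + grid 0 (mesh h n) i = grid t (mesh h n) i := fun i => by
    simp [grid]
  simp only [hg] at h2
  rw [h2]
  unfold riemannSum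
  simp only [Finset.sum_range]
  push_cast
  rfl

/-- The characteristic function of an increment of the log-price. -/
lemma integral_exp_increment [IsProbabilityMeasure μ] (hmodel : IsStochVolModel F σ W X μ)
    (hA : AssumptionA σ μ) (hB : AssumptionB σ μ) (t : ℝ≥0) {h : ℝ≥0} (hh : 0 < h) (u : ℝ) :
    ∫ ω, Complex.exp (u * (X (t + h) ω - X t ω : ℝ) * Complex.I) ∂μ
      = ∫ ω, Complex.exp (-(u ^ 2 / 2 * (intVar σ h ω).toReal : ℝ)) ∂μ := by
  have hY := hmodel.aemeasurable_sampledIntegral t h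
  have hX := hmodel.ito.aemeasurable
  have hσ := hmodel.measurable_vol
  have hc : Continuous fun x : ℝ => Complex.exp (u * (x : ℂ) * Complex.I) := by fun_prop
  have hc' : Continuous fun x : ℝ => Complex.exp (-(u ^ 2 / 2 * x : ℝ)) := by fun_prop
  -- Both sides of the sampled identity pass to the limit by Lipschitz bounds: `x ↦ exp (iux)` on
  -- the left, `x ↦ exp (-u² x / 2)` on `[0, ∞)` on the right.
  have hlim1 := tendsto_integral_of_enorm_sub_le (μ := μ)
    (g := fun n ω => Complex.exp (u * (sampledIntegral σ W t h n ω : ℝ) * Complex.I))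
    (g' := fun ω => Complex.exp (u * (X (t + h) ω - X t ω : ℝ) * Complex.I))
    (C := ‖u‖ₑ) enorm_ne_top
    (fun n => (hc.measurable.comp_aemeasurable (hY n)).aestronglyMeasurable)
    (fun n ω => by rw [← Complex.ofReal_mul, Complex.norm_exp_ofReal_mul_I])
    (hc.measurable.comp_aemeasurable ((hX _).sub (hX _))).aestronglyMeasurable
    (fun n ω => enorm_cexp_mul_I_sub_le u _ _)
    (tendsto_lintegral_enorm_of_sq (fun n => (hY n).sub ((hX _).sub (hX _)))
      (hmodel.tendsto_sampledIntegral hA hB t hh))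
  have hR : ∀ n, Measurable fun ω => (riemannSum σ h n ω : ℝ) := fun n =>
    (Finset.measurable_sum _ fun i _ =>
      ((measurable_of_uncurry hσ _).pow_const 2).mul_const _).coe_nnreal_real
  have hlim2 := tendsto_integral_of_enorm_sub_le (μ := μ)
    (g := fun n ω => Complex.exp (-(u ^ 2 / 2 * riemannSum σ h n ω : ℝ)))
    (g' := fun ω => Complex.exp (-(u ^ 2 / 2 * (intVar σ h ω).toReal : ℝ)))
    (C := ‖u ^ 2 / 2‖ₑ) enorm_ne_top
    (fun n => (hc'.measurable.comp (hR n)).aestronglyMeasurable)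
    (fun n ω => by
      rw [← Complex.ofReal_neg, ← Complex.ofReal_exp, Complex.norm_real, Real.norm_eq_abs,
        abs_of_pos (Real.exp_pos _)]
      exact Real.exp_le_one_iff.2 (neg_nonpos.2 (by positivity)))
    (hc'.measurable.comp (measurable_intVar hσ h).ennreal_toReal).aestronglyMeasurable
    (fun n ω => by
      rw [← Complex.ofReal_neg, ← Complex.ofReal_exp, ← Complex.ofReal_neg, ← Complex.ofReal_exp,
        ← Complex.ofReal_sub, ← enorm_mul, ← ofReal_norm, ← ofReal_norm,
        Complex.norm_real, Real.norm_eq_abs, Real.norm_eq_abs, mul_sub]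
      exact ENNReal.ofReal_le_ofReal
        (abs_exp_neg_sub_exp_neg_le (by positivity) (by positivity)))
    (tendsto_riemannSum hmodel.stationary hσ hA hB hh)
  refine tendsto_nhds_unique hlim1 (hlim2.congr fun n => ?_)
  exact (hmodel.integral_exp_sampledIntegral t h n u).symm

/-- The increment `X (t + h) - X t` is distributed as `√(∫_0^h σ²) * N` with `N` a standard
Gaussian independent of `σ`. -/
lemma map_increment [IsProbabilityMeasure μ] (hmodel : IsStochVolModel F σ W X μ)
    (hA : AssumptionA σ μ) (hB : AssumptionB σ μ) (t : ℝ≥0) {h : ℝ≥0} (hh : 0 < h) :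
    μ.map (fun ω => X (t + h) ω - X t ω)
      = (μ.prod (gaussianReal 0 1)).map fun p => √(intVar σ h p.1).toReal * p.2 := by
  have hX : AEMeasurable (fun ω => X (t + h) ω - X t ω) μ :=
    (hmodel.ito.aemeasurable _).sub (hmodel.ito.aemeasurable _)
  have hv : Measurable fun p : Ω × ℝ => √(intVar σ h p.1).toReal * p.2 :=
    (((measurable_intVar hmodel.measurable_vol h).ennreal_toReal.sqrt).comp measurable_fst).mul
      measurable_snd
  have hP1 := Measure.isProbabilityMeasure_map hX
  have hP2 : IsProbabilityMeasure ((μ.prod (gaussianReal 0 1)).map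
      fun p => √(intVar σ h p.1).toReal * p.2) :=
    Measure.isProbabilityMeasure_map hv.aemeasurable
  refine Measure.ext_of_charFun ?_
  funext u
  have hc : Continuous fun x : ℝ => Complex.exp (u * (x : ℂ) * Complex.I) := by fun_prop
  rw [charFun_apply_real, charFun_apply_real, integral_map hX hc.aestronglyMeasurable,
    integral_map hv.aemeasurable hc.aestronglyMeasurable,
    hmodel.integral_exp_increment hA hB t hh u, integral_prod]
  · refine integral_congr_ae (ae_of_all _ fun ω => ?_)
    set v := (intVar σ h ω).toReal with hvdef
    have h1 : ∀ x : ℝ, Complex.exp (u * ((√v * x : ℝ) : ℂ) * Complex.I)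
        = Complex.exp ((u * √v : ℝ) * (x : ℂ) * Complex.I) := fun x => by
      congr 1; push_cast; ring
    simp only [← hvdef, h1]
    rw [← charFun_apply_real, charFun_gaussianReal]
    congr 1
    have hsq : (√v) ^ 2 = v := Real.sq_sqrt ENNReal.toReal_nonneg
    nth_rewrite 1 [← hsq]
    push_cast
    ring
  · refine Integrable.of_bound (hc.measurable.comp hv).aestronglyMeasurable 1
      (ae_of_all _ fun p => ?_)
    rw [← Complex.ofReal_mul, Complex.norm_exp_ofReal_mul_I]

/-- The absolute moment of order `q` of the standard Gaussian distribution. -/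
def gaussianMoment (q : ℝ) : ℝ≥0∞ := ∫⁻ x, ‖x‖ₑ ^ q ∂(gaussianReal 0 1)

lemma gaussianMoment_ne_top {q : ℝ} (hq : 0 < q) : gaussianMoment q ≠ ∞ := by
  have h := memLp_id_gaussianReal (μ := 0) (v := 1) q.toNNReal
  have h2 := (eLpNorm_lt_top_iff_lintegral_rpow_enorm_lt_top (by simpa using hq)
    ENNReal.coe_ne_top).1 h.2
  simpa [gaussianMoment, hq.le] using h2.ne

lemma gaussianMoment_ne_zero {q : ℝ} (hq : 0 < q) : gaussianMoment q ≠ 0 := by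
  intro h
  rw [gaussianMoment, lintegral_eq_zero_iff (by fun_prop)] at h
  have hna := nullSingletonClass_gaussianReal (μ := 0) (v := 1) one_ne_zero
  have h2 : ∀ᵐ x ∂(gaussianReal 0 1), x ≠ 0 := by
    rw [ae_iff]
    simp
  obtain ⟨x, hx, hx0⟩ := (h.and h2).exists
  simp [ENNReal.rpow_eq_zero_iff, hx0, hq] at hx

/-- The moments of the increments are those of the integrated squared volatility. -/
lemma lintegral_increment_rpow [IsProbabilityMeasure μ] (hmodel : IsStochVolModel F σ W X μ)
    (hA : AssumptionA σ μ) (hB : AssumptionB σ μ) (t : ℝ≥0) {h : ℝ≥0} (hh : 0 < h)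
    {q : ℝ} (hq : 0 < q) :
    ∫⁻ ω, ‖X (t + h) ω - X t ω‖ₑ ^ q ∂μ
      = gaussianMoment q * ∫⁻ ω, intVar σ h ω ^ (q / 2) ∂μ := by
  have hX : AEMeasurable (fun ω => X (t + h) ω - X t ω) μ :=
    (hmodel.ito.aemeasurable _).sub (hmodel.ito.aemeasurable _)
  have hV := measurable_intVar hmodel.measurable_vol h
  have hv : Measurable fun p : Ω × ℝ => √(intVar σ h p.1).toReal * p.2 :=
    (hV.ennreal_toReal.sqrt.comp measurable_fst).mul measurable_snd
  have hm : Measurable fun x : ℝ => ‖x‖ₑ ^ q := by fun_prop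
  have hmv : AEMeasurable (fun p : Ω × ℝ => ‖√(intVar σ h p.1).toReal * p.2‖ₑ ^ q)
      (μ.prod (gaussianReal 0 1)) := (hm.comp hv).aemeasurable
  rw [← lintegral_map' (f := fun x : ℝ => ‖x‖ₑ ^ q) hm.aemeasurable hX,
    hmodel.map_increment hA hB t hh, lintegral_map hm hv,
    lintegral_prod _ hmv,
    ← lintegral_const_mul _ (hV.pow_const _)]
  refine lintegral_congr_ae ?_
  -- Finiteness matters here: `toReal` sends `∞` to `0`, so the representation recovers `intVar`
  -- only where it is finite.
  filter_upwards [ae_intVar_lt_top hmodel.stationary hmodel.measurable_vol hB h] with ω hω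
  simp only [enorm_mul, ENNReal.mul_rpow_of_nonneg _ _ hq.le]
  rw [lintegral_const_mul _ hm, mul_comm]
  congr 1
  rw [Real.enorm_eq_ofReal (Real.sqrt_nonneg _), Real.sqrt_eq_rpow,
    ← ENNReal.ofReal_rpow_of_nonneg ENNReal.toReal_nonneg (by norm_num),
    ENNReal.ofReal_toReal hω.ne, ← ENNReal.rpow_mul]
  congr 1
  ring

end IsStochVolModel

end Law

/-! ### From moment bounds to the scaling exponent and back -/

section Scaling

variable {μ : Measure Ω} {X : ℝ≥0 → Ω → ℝ}

lemma eventually_pos_lt_one : ∀ᶠ h : ℝ≥0 in 𝓝[>] 0, 0 < h ∧ h < 1 := by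
  filter_upwards [self_mem_nhdsWithin, mem_nhdsWithin_of_mem_nhds (Iio_mem_nhds zero_lt_one)]
    with h h0 h1 using ⟨h0, h1⟩

lemma tendsto_log_coe : Tendsto (fun h : ℝ≥0 => Real.log h) (𝓝[>] 0) atBot := by
  refine Real.tendsto_log_nhdsGT_zero.comp (tendsto_nhdsWithin_iff.2 ⟨?_, ?_⟩)
  · exact tendsto_nhdsWithin_of_tendsto_nhds (NNReal.tendsto_coe.2 tendsto_id)
  · filter_upwards [self_mem_nhdsWithin] with h h0
    exact_mod_cast h0

/-- A moment bound of order `h ^ (q / 2)` forces `A(q) ≥ q / 2`. -/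
lemma le_scalingExponent {t : ℝ≥0} {q : ℝ} {C : ℝ≥0∞} (hC : C ≠ ∞)
    (hle : ∀ h : ℝ≥0, 0 < h →
      ∫⁻ ω, ‖X (t + h) ω - X t ω‖ₑ ^ q ∂μ ≤ C * (h : ℝ≥0∞) ^ (q / 2)) :
    ((q / 2 : ℝ) : EReal) ≤ scalingExponent X μ t q := by
  -- Adding `1` keeps `log c` finite even if `C = 0`; its contribution `log c / log h` vanishes in
  -- the limit.
  set c : ℝ := C.toReal + 1 with hc
  have hc0 : 0 < c := by positivity
  have hCc : C ≤ ENNReal.ofReal c := by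
    rw [← ENNReal.ofReal_toReal hC]
    exact ENNReal.ofReal_le_ofReal (by linarith)
  have hlim : Tendsto (fun h : ℝ≥0 => ((Real.log c / Real.log h + q / 2 : ℝ) : EReal)) (𝓝[>] 0)
      (𝓝 ((q / 2 : ℝ) : EReal)) := by
    refine (continuous_coe_real_ereal.tendsto _).comp ?_
    simpa using (tendsto_log_coe.const_div_atBot (Real.log c)).add_const (q / 2)
  rw [← hlim.limsup_eq]
  refine limsup_le_limsup ?_
  filter_upwards [eventually_pos_lt_one] with h ⟨h0, h1⟩
  have h0' : (0 : ℝ) < h := h0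
  have hlog : Real.log h < 0 := Real.log_neg h0' h1
  have hM : ∫⁻ ω, ‖X (t + h) ω - X t ω‖ₑ ^ q ∂μ ≤ ENNReal.ofReal (c * (h : ℝ) ^ (q / 2)) := by
    rw [ENNReal.ofReal_mul hc0.le, ← ENNReal.ofReal_rpow_of_pos h0', ENNReal.ofReal_coe_nnreal]
    exact (hle h h0).trans (by gcongr)
  have hpos : 0 < c * (h : ℝ) ^ (q / 2) := mul_pos hc0 (Real.rpow_pos_of_pos h0' _)
  have hlogM := ENNReal.log_le_log hM
  rw [ENNReal.log_ofReal_of_pos hpos, Real.log_mul hc0.ne' (Real.rpow_pos_of_pos h0' _).ne',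
    Real.log_rpow h0'] at hlogM
  have e : Real.log c / Real.log h + q / 2 = (Real.log c + q / 2 * Real.log h) / Real.log h := by
    rw [add_div, mul_div_cancel_right₀ _ hlog.ne]
  rw [e, EReal.coe_div]
  exact EReal.div_le_div_right_of_nonpos (by exact_mod_cast hlog.le) hlogM

/-- If the moment were infinite for every `h > 0`, the quotient would be `∞` divided by a negative
number, that is `-∞`, for all small `h`. -/
lemma exists_moment_ne_top {t : ℝ≥0} {q : ℝ} (h : ⊥ < scalingExponent X μ t q) :
    ∃ h : ℝ≥0, 0 < h ∧ ∫⁻ ω, ‖X (t + h) ω - X t ω‖ₑ ^ q ∂μ ≠ ∞ := by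
  by_contra! hcon
  refine h.ne' ?_
  unfold scalingExponent
  rw [limsup_congr (v := fun _ => (⊥ : EReal)), limsup_const_bot]
  filter_upwards [eventually_pos_lt_one] with h ⟨h0, h1⟩
  have hlog : Real.log h < 0 := Real.log_neg (by exact_mod_cast h0) h1
  rw [hcon h h0, ENNReal.log_top]
  exact EReal.top_div_of_neg_ne_bot (by exact_mod_cast hlog) (EReal.coe_ne_bot _)

end Scaling

/-! ### Moments of the integrated variance -/

section Moments

variable {μ : Measure Ω} {F : Filtration ℝ≥0 mΩ} {σ : ℝ≥0 → Ω → ℝ≥0} {W X : ℝ≥0 → Ω → ℝ}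

lemma lintegral_intVar_rpow_le_of_le_one [IsProbabilityMeasure μ] (hst : IsStationary σ μ)
    (hσ : Measurable fun p : ℝ × Ω => σ p.1.toNNReal p.2) (h : ℝ≥0) {r : ℝ} (hr0 : 0 < r)
    (hr1 : r ≤ 1) :
    ∫⁻ ω, intVar σ h ω ^ r ∂μ ≤ (∫⁻ ω, (σ 0 ω : ℝ≥0∞) ^ 2 ∂μ) ^ r * (h : ℝ≥0∞) ^ r := by
  -- Jensen with the convex power `r⁻¹ ≥ 1` applied to `intVar ^ r`, so that only the first moment
  -- of `intVar` enters.
  have hj := lintegral_rpow_le_lintegral_rpow (ν := μ)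
    ((measurable_intVar hσ h).pow_const r).aemeasurable (r := r⁻¹) ((one_le_inv₀ hr0).2 hr1)
  simp only [← ENNReal.rpow_mul, mul_inv_cancel₀ hr0.ne', ENNReal.rpow_one] at hj
  rw [lintegral_intVar hst hσ] at hj
  calc ∫⁻ ω, intVar σ h ω ^ r ∂μ = ((∫⁻ ω, intVar σ h ω ^ r ∂μ) ^ r⁻¹) ^ r := by
        rw [← ENNReal.rpow_mul, inv_mul_cancel₀ hr0.ne', ENNReal.rpow_one]
    _ ≤ (h * ∫⁻ ω, (σ 0 ω : ℝ≥0∞) ^ 2 ∂μ) ^ r := by gcongr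
    _ = _ := by rw [ENNReal.mul_rpow_of_nonneg _ _ hr0.le, mul_comm]

lemma lintegral_intVar_rpow_le_of_one_le [IsProbabilityMeasure μ] (hst : IsStationary σ μ)
    (hσ : Measurable fun p : ℝ × Ω => σ p.1.toNNReal p.2) {h : ℝ≥0} (hh : 0 < h) {r : ℝ}
    (hr1 : 1 ≤ r) :
    ∫⁻ ω, intVar σ h ω ^ r ∂μ ≤ (∫⁻ ω, (σ 0 ω : ℝ≥0∞) ^ (2 * r) ∂μ) * (h : ℝ≥0∞) ^ r := by
  have hr0 : 0 ≤ r := by linarith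
  have hh0 : (h : ℝ≥0∞) ≠ 0 := by simpa using hh.ne'
  have hht : (h : ℝ≥0∞) ≠ ∞ := ENNReal.coe_ne_top
  -- The uniform distribution on `(0, h]`: Jensen is applied in time for each fixed `ω`, and
  -- stationarity then evaluates the mean.
  set ν : Measure ℝ := (h : ℝ≥0∞)⁻¹ • volume.restrict (Set.Ioc (0 : ℝ) h) with hν
  have hνp : IsProbabilityMeasure ν := ⟨by
    rw [hν, Measure.smul_apply, Measure.restrict_apply_univ, Real.volume_Ioc, sub_zero,
      ENNReal.ofReal_coe_nnreal, smul_eq_mul, ENNReal.inv_mul_cancel hh0 hht]⟩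
  have hpt : ∀ ω, intVar σ h ω ^ r
      ≤ (h : ℝ≥0∞) ^ r * ((h : ℝ≥0∞)⁻¹ * timeIntegral h fun s => (σ s ω : ℝ≥0∞) ^ (2 * r)) := by
    intro ω
    have hσω : Measurable fun s : ℝ => (σ s.toNNReal ω : ℝ≥0∞) ^ 2 :=
      (hσ.comp measurable_prodMk_right).coe_nnreal_ennreal.pow_const 2
    have hj := lintegral_rpow_le_lintegral_rpow (ν := ν) hσω.aemeasurable hr1
    rw [hν, lintegral_smul_measure, lintegral_smul_measure, smul_eq_mul, smul_eq_mul] at hj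
    have hpow : ∀ x : ℝ≥0∞, (x ^ 2) ^ r = x ^ (2 * r) := fun x => by
      rw [ENNReal.rpow_mul]; norm_num
    simp only [hpow] at hj
    calc intVar σ h ω ^ r = (h * ((h : ℝ≥0∞)⁻¹ * intVar σ h ω)) ^ r := by
          rw [← mul_assoc, ENNReal.mul_inv_cancel hh0 hht, one_mul]
      _ = (h : ℝ≥0∞) ^ r * ((h : ℝ≥0∞)⁻¹ * intVar σ h ω) ^ r :=
          ENNReal.mul_rpow_of_nonneg _ _ hr0
      _ ≤ _ := by gcongr; exact hj
  refine (lintegral_mono hpt).trans (le_of_eq ?_)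
  rw [lintegral_const_mul' _ _ (ENNReal.rpow_ne_top_of_nonneg hr0 hht),
    lintegral_const_mul' _ _ (ENNReal.inv_ne_top.2 hh0),
    lintegral_timeIntegral_comp hst hσ (g := fun x => (x : ℝ≥0∞) ^ (2 * r)) (by fun_prop),
    ← mul_assoc (_⁻¹), ENNReal.inv_mul_cancel hh0 hht, one_mul, mul_comm]

lemma intVar_mono {h h' : ℝ≥0} (hle : h ≤ h') (ω : Ω) : intVar σ h ω ≤ intVar σ h' ω :=
  lintegral_mono_set (Set.Ioc_subset_Ioc_right (NNReal.coe_le_coe.2 hle))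

namespace IsStochVolModel

lemma lintegral_intVar_rpow_ne_top_iff [IsProbabilityMeasure μ]
    (hmodel : IsStochVolModel F σ W X μ) (hA : AssumptionA σ μ) (hB : AssumptionB σ μ) (t : ℝ≥0)
    {h : ℝ≥0} (hh : 0 < h) {q : ℝ} (hq : 0 < q) :
    ∫⁻ ω, intVar σ h ω ^ (q / 2) ∂μ ≠ ∞ ↔ ∫⁻ ω, ‖X (t + h) ω - X t ω‖ₑ ^ q ∂μ ≠ ∞ := by
  rw [hmodel.lintegral_increment_rpow hA hB t hh hq]
  constructor
  · exact ENNReal.mul_ne_top (gaussianMoment_ne_top hq)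
  · intro hne htop
    rw [htop, ENNReal.mul_top (gaussianMoment_ne_zero hq)] at hne
    exact hne rfl

/-- The argument passes through `X`: the increment over `(0, 2h]` is the sum of those over `(0, h]`
and `(h, 2h]`, and the `q`-th moment of each is the same multiple of that of `intVar σ h`. -/
lemma lintegral_intVar_rpow_add_self_ne_top [IsProbabilityMeasure μ]
    (hmodel : IsStochVolModel F σ W X μ) (hA : AssumptionA σ μ) (hB : AssumptionB σ μ)
    {h : ℝ≥0} (hh : 0 < h) {q : ℝ} (hq : 1 ≤ q) (hfin : ∫⁻ ω, intVar σ h ω ^ (q / 2) ∂μ ≠ ∞) :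
    ∫⁻ ω, intVar σ (h + h) ω ^ (q / 2) ∂μ ≠ ∞ := by
  have hq0 : 0 < q := by linarith
  rw [hmodel.lintegral_intVar_rpow_ne_top_iff hA hB 0 (add_pos hh hh) hq0]
  have h1 := (hmodel.lintegral_intVar_rpow_ne_top_iff hA hB h hh hq0).1 hfin
  have h2 := (hmodel.lintegral_intVar_rpow_ne_top_iff hA hB 0 hh hq0).1 hfin
  simp only [zero_add] at h2 ⊢
  have hm : AEMeasurable (fun ω => ‖X (h + h) ω - X h ω‖ₑ ^ q) μ :=
    (((hmodel.ito.aemeasurable _).sub (hmodel.ito.aemeasurable _)).enorm.pow_const q)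
  refine ne_top_of_le_ne_top (b := 2 ^ (q - 1) * (∫⁻ ω, ‖X (h + h) ω - X h ω‖ₑ ^ q ∂μ
    + ∫⁻ ω, ‖X h ω - X 0 ω‖ₑ ^ q ∂μ)) ?_ ?_
  · exact ENNReal.mul_ne_top (ENNReal.rpow_ne_top_of_nonneg (by linarith) (by norm_num))
      (ENNReal.add_ne_top.2 ⟨h1, h2⟩)
  · rw [← lintegral_add_left' hm, ← lintegral_const_mul' _ _
      (ENNReal.rpow_ne_top_of_nonneg (by linarith) (by norm_num))]
    refine lintegral_mono fun ω => ?_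
    refine le_trans ?_ (ENNReal.rpow_add_le_mul_rpow_add_rpow _ _ hq)
    gcongr
    have e : X (h + h) ω - X 0 ω = (X (h + h) ω - X h ω) + (X h ω - X 0 ω) := by ring
    rw [e]
    exact enorm_add_le _ _

lemma lintegral_intVar_rpow_ne_top [IsProbabilityMeasure μ]
    (hmodel : IsStochVolModel F σ W X μ) (hA : AssumptionA σ μ) (hB : AssumptionB σ μ)
    {h₀ : ℝ≥0} (hh : 0 < h₀) {q : ℝ} (hq : 1 ≤ q)
    (hfin : ∫⁻ ω, intVar σ h₀ ω ^ (q / 2) ∂μ ≠ ∞) (h : ℝ≥0) :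
    ∫⁻ ω, intVar σ h ω ^ (q / 2) ∂μ ≠ ∞ := by
  have hdouble : ∀ n : ℕ, ∫⁻ ω, intVar σ (2 ^ n * h₀) ω ^ (q / 2) ∂μ ≠ ∞ := by
    intro n
    induction n with
    | zero => simpa using hfin
    | succ n ih =>
      have e : (2 : ℝ≥0) ^ (n + 1) * h₀ = 2 ^ n * h₀ + 2 ^ n * h₀ := by ring
      rw [e]
      exact hmodel.lintegral_intVar_rpow_add_self_ne_top hA hB (by positivity) hq ih
  -- Finitely many doublings of `h₀` exceed `h`, and `intVar` is monotone in the horizon.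
  obtain ⟨n, hn⟩ := pow_unbounded_of_one_lt (h / h₀) (one_lt_two (α := ℝ≥0))
  refine ne_top_of_le_ne_top (hdouble n) (lintegral_mono fun ω => ?_)
  exact ENNReal.rpow_le_rpow (intVar_mono ((div_le_iff₀ hh).1 hn.le) ω) (by linarith)

end IsStochVolModel

end Moments

end StochVol

end

theorem mainTheorem6 {Ω : Type*} {mΩ : MeasurableSpace Ω} (μ : Measure Ω) [IsProbabilityMeasure μ]
    (F : Filtration ℝ≥0 mΩ) (σ : ℝ≥0 → Ω → ℝ≥0) (W X : ℝ≥0 → Ω → ℝ)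
    (hmodel : StochVol.IsStochVolModel F σ W X μ)
    (hA : StochVol.AssumptionA σ μ) (hB : StochVol.AssumptionB σ μ)
    (t : ℝ≥0) (hms : StochVol.MultiScaling X μ t) :
    ∃ p : ℝ, 2 < p ∧
      (∀ h : ℝ≥0, 0 < h →
        ∫⁻ ω, ((h : ℝ≥0∞)⁻¹ *
          StochVol.timeIntegral h (fun s => (σ s ω : ℝ≥0∞) ^ 2)) ^ (p / 2) ∂μ < ∞) ∧
      ∫⁻ ω, (σ 0 ω : ℝ≥0∞) ^ p ∂μ = ∞ := by
  obtain ⟨q, hq⟩ := hms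
  obtain ⟨hq1, hbot, hlt⟩ := interior_subset hq
  have hq0 : 0 < q := by linarith
  have hσ := hmodel.measurable_vol
  have hst := hmodel.stationary
  -- A moment bound of the diffusive order `h ^ (q / 2)` would give `A(q) ≥ q / 2`. This
  -- contradiction is used twice: to get `q > 2` and to show that `σ 0` has infinite `q`-th moment.
  have hbound : ∀ C : ℝ≥0∞, C ≠ ∞ → (∀ h : ℝ≥0, 0 < h →
      ∫⁻ ω, StochVol.intVar σ h ω ^ (q / 2) ∂μ ≤ C * (h : ℝ≥0∞) ^ (q / 2)) → False := by
    intro C hC hle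
    refine absurd hlt (not_lt.2 (StochVol.le_scalingExponent
      (ENNReal.mul_ne_top (StochVol.IsStochVolModel.gaussianMoment_ne_top hq0) hC)
      fun h hh => ?_))
    rw [hmodel.lintegral_increment_rpow hA hB t hh hq0, mul_assoc]
    gcongr
    exact hle h hh
  have hq2 : 2 < q := by
    by_contra hcon
    refine hbound _ ?_ fun h _ => StochVol.lintegral_intVar_rpow_le_of_le_one hst hσ h
      (half_pos hq0) (by linarith)
    exact ENNReal.rpow_ne_top_of_nonneg (by linarith) (ne_of_lt hB)
  refine ⟨q, hq2, fun h hh => ?_, ?_⟩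
  · obtain ⟨h₀, hh₀, hfin⟩ := StochVol.exists_moment_ne_top hbot
    have hV := hmodel.lintegral_intVar_rpow_ne_top hA hB hh₀ hq1
      ((hmodel.lintegral_intVar_rpow_ne_top_iff hA hB t hh₀ hq0).2 hfin) h
    have hinv : (h : ℝ≥0∞)⁻¹ ^ (q / 2) ≠ ∞ :=
      ENNReal.rpow_ne_top_of_nonneg (by linarith) (ENNReal.inv_ne_top.2 (by simpa using hh.ne'))
    simp_rw [ENNReal.mul_rpow_of_nonneg _ _ (half_pos hq0).le]
    rw [lintegral_const_mul' _ _ hinv]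
    exact (ENNReal.mul_ne_top hinv hV).lt_top
  · by_contra hfin
    refine hbound _ hfin fun h hh => ?_
    have := StochVol.lintegral_intVar_rpow_le_of_one_le hst hσ hh (r := q / 2) (by linarith)
    rwa [mul_div_cancel₀ q two_ne_zero] at this
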